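/- Let $W$ be a space–time white noise on $\mathbb{R}\times[0,\infty)$, let $p(x,t)=(2\pi t)^{-1/2}e^{-x^2/(2t)}$ be the heat kernel, fix $x\in\mathbb{R}$, and let $$F(t)=\int_{\mathbb{R}\times[0,t]}p(x-y,t-r)\,W(dy\times dr),\qquad t\ge 0,$$ so that $F(t)=u(x,t)$, where $u$ is the solution to the stochastic heat equation $\partial_t u=\tfrac12\partial_x^2u+\dot W$ with $u(\cdot,0)\equiv0$. For a positive integer $n$ put $\Delta t=1/n$, $t_j=j\Delta t$ and $\Delta F_j=F(t_j)-F(t_{j-1})$. For integers $0\le r\le k$, let $C^{k,1}_r(\mathbb{R}\times[0,\infty))$ be the set of continuous $g:\mathbb{R}\times[0,\infty)\to\mathbb{R}$ such that $\partial_x^jg$ exists and is continuous on $\mathbb{R}\times[0,\infty)$ for $0\le j\le k$; $\partial_t\partial_x^jg$ exists and is continuous on $\mathbb{R}\times(0,\infty)$ for $0\le j\le r$; and $\limsup_{t\to0}\sup_{x\in K}|\partial_t\partial_x^jg(x,t)|<\infty$ for every compact $K\subset\mathbb{R}$ and $0\le j\le r$. **Theorem 5.1.** Let $g\in C^{7,1}_2(\mathbb{R}\times[0,\infty))$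 have compact support and let $T>0$. There is a constant $C$, depending only on $g$ and $T$, such that for every positive integer $n$ and all integers $c,d$ with $0\le t_c<t_d\le T$, $$E\Bigl|\sum_{j=c+1}^{d}\{g(F(t_{j-1}),t_{j-1})-g(F(t_c),t_c)\}\,\Delta F_j^2\,(-1)^j\Bigr|^2\le C\,|t_d-t_c|^{3/2}.$$ -/

import Mathlib

open MeasureTheory ProbabilityTheory Set Filter Topology
open scoped NNReal ENNReal

noncomputable section

namespace QuarticHeat

/-- The heat kernel `p(x,t) = (2πt)^{-1/2} exp(-x²/(2t))`. -/
def heatKernel (x t : ℝ) : ℝ :=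
  (√(2 * Real.pi * t))⁻¹ * Real.exp (-x ^ 2 / (2 * t))

/-- Lebesgue measure on the space-time half plane `ℝ × [0,∞)`; the points are `(y, r)`. -/
def spaceTime : Measure (ℝ × ℝ) :=
  (volume : Measure ℝ).prod (volume.restrict (Ici (0 : ℝ)))

/-- The Hilbert space `L²(ℝ × [0,∞))`. -/
abbrev SpaceTimeL2 : Type := Lp ℝ 2 spaceTime

/-- The integrand `(y,r) ↦ 1_{[0,t]}(r) p(x - y, t - r)`. -/
def heatIntegrand (x t : ℝ) : ℝ × ℝ → ℝ :=
  fun q => (Icc (0 : ℝ) t).indicator (fun r => heatKernel (x - q.1) (t - r)) q.2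

/-- The heat integrand is square integrable on `ℝ × [0,∞)`. -/
theorem memLp_heatIntegrand (x t : ℝ) : MemLp (heatIntegrand x t) 2 spaceTime := by
  have hmeas : Measurable (heatIntegrand x t) := by
    have h : heatIntegrand x t = (univ ×ˢ Icc (0 : ℝ) t).indicator
        (fun q : ℝ × ℝ => heatKernel (x - q.1) (t - q.2)) := by
      funext q
      by_cases hq : q.2 ∈ Icc (0 : ℝ) t
      · simp [heatIntegrand, indicator, mem_prod]
      · simp [heatIntegrand, indicator, mem_prod]
    rw [h]
    refine Measurable.indicator ?_ (MeasurableSet.univ.prod measurableSet_Icc)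
    unfold heatKernel
    fun_prop
  rw [memLp_two_iff_integrable_sq hmeas.aestronglyMeasurable]
  have hsq : ∀ s : ℝ, 0 < s → ∀ y : ℝ, heatKernel (x - y) s ^ 2
      = (2 * Real.pi * s)⁻¹ * Real.exp (-s⁻¹ * (y - x) ^ 2) := by
    intro s hs y
    unfold heatKernel
    rw [mul_pow, inv_pow, Real.sq_sqrt (by positivity), ← Real.exp_nat_mul]
    congr 2
    push_cast
    field_simp
    ring
  have hint : ∀ s : ℝ, 0 < s → Integrable (fun y : ℝ => heatKernel (x - y) s ^ 2) := by
    intro s hs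
    simp_rw [hsq s hs]
    exact ((integrable_exp_neg_mul_sq (inv_pos.2 hs)).comp_sub_right x).const_mul _
  have hval : ∀ s : ℝ, 0 < s → ∫ y : ℝ, heatKernel (x - y) s ^ 2
      = (2 * √Real.pi)⁻¹ * s ^ (-(1 / 2) : ℝ) := by
    intro s hs
    simp_rw [hsq s hs]
    rw [integral_const_mul,
      integral_sub_right_eq_self (fun y : ℝ => Real.exp (-s⁻¹ * y ^ 2)) x, integral_gaussian,
      Real.rpow_neg hs.le, ← Real.sqrt_eq_rpow, div_inv_eq_mul,
      Real.sqrt_mul Real.pi_pos.le]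
    have h1 : √Real.pi ≠ 0 := (Real.sqrt_pos.2 Real.pi_pos).ne'
    have h2 : √s ≠ 0 := (Real.sqrt_pos.2 hs).ne'
    have h3 : √Real.pi ^ 2 = Real.pi := Real.sq_sqrt Real.pi_pos.le
    have h4 : √s ^ 2 = s := Real.sq_sqrt hs.le
    have h5 := Real.pi_pos.ne'
    field_simp
    rw [h3, h4]
  have hne : ∀ᵐ r ∂(volume.restrict (Ici (0 : ℝ))), r ≠ t :=
    ae_restrict_of_ae (by simp [ae_iff])
  unfold spaceTime
  rw [integrable_prod_iff' (by exact (hmeas.pow_const 2).aestronglyMeasurable)]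
  constructor
  · filter_upwards [hne] with r hr
    by_cases h : r ∈ Icc (0 : ℝ) t
    · have : 0 < t - r := sub_pos.2 (lt_of_le_of_ne h.2 hr)
      simpa [heatIntegrand, h] using hint _ this
    · simp [heatIntegrand, h]
  · have hbase : IntegrableOn (fun r : ℝ => (2 * √Real.pi)⁻¹ * (t - r) ^ (-(1 / 2) : ℝ))
        (Ioc 0 t) := by
      rcases le_or_gt t 0 with ht | ht
      · simp [Ioc_eq_empty (not_lt.2 ht)]
      · have h1 : IntervalIntegrable (fun r : ℝ => r ^ (-(1 / 2) : ℝ)) volume 0 t :=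
          intervalIntegral.intervalIntegrable_rpow' (by norm_num)
        have h2 := (h1.comp_sub_left t).symm
        simp only [sub_zero, sub_self] at h2
        exact ((intervalIntegrable_iff_integrableOn_Ioc_of_le ht.le).1 h2).const_mul _
    have hind : Integrable ((Ioc 0 t).indicator
        (fun r : ℝ => (2 * √Real.pi)⁻¹ * (t - r) ^ (-(1 / 2) : ℝ)))
        (volume.restrict (Ici (0 : ℝ))) :=
      ((integrable_indicator_iff measurableSet_Ioc).2 hbase).restrict
    refine hind.congr ?_
    have hn0 : ∀ᵐ r ∂(volume.restrict (Ici (0 : ℝ))), r ≠ 0 :=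
      ae_restrict_of_ae (by simp [ae_iff])
    filter_upwards [hne, hn0] with r hr hr0
    by_cases h : r ∈ Icc (0 : ℝ) t
    · have hs : 0 < t - r := sub_pos.2 (lt_of_le_of_ne h.2 hr)
      have h' : r ∈ Ioc (0 : ℝ) t := ⟨lt_of_le_of_ne h.1 (Ne.symm hr0), h.2⟩
      simp only [heatIntegrand, indicator_of_mem h, indicator_of_mem h']
      rw [← hval _ hs]
      refine integral_congr_ae (Eventually.of_forall fun y => ?_)
      simp
    · have h' : r ∉ Ioc (0 : ℝ) t := fun h2 => h ⟨h2.1.le, h2.2⟩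
      simp [heatIntegrand, h, h']

/-- The heat integrand as an element of `L²(ℝ × [0,∞))`. -/
def heatL2 (x t : ℝ) : SpaceTimeL2 := (memLp_heatIntegrand x t).toLp (heatIntegrand x t)

/-- A space-time white noise on `ℝ × [0,∞)` over a probability space, given by its Wiener integral
`h ↦ ∫ h dW`: a linear map from `L²(ℝ × [0,∞))` to `L²(P)` such that `∫ h dW` is a centered
Gaussian variable of variance `‖h‖²`. By linearity the family is jointly Gaussian with
`E[∫ h dW ∫ k dW] = ⟪h, k⟫`, and `W(A) = ∫ 1_A dW` when `A` has finite Lebesgue measure. -/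
structure WhiteNoise {Ω : Type*} [MeasurableSpace Ω] (P : Measure Ω) where
  /-- The Wiener integral `h ↦ ∫ h dW`. -/
  integral : SpaceTimeL2 →ₗ[ℝ] Lp ℝ 2 P
  /-- `∫ h dW` has law `N(0, ‖h‖²)`. -/
  hasLaw_integral : ∀ h : SpaceTimeL2, HasLaw (integral h) (gaussianReal 0 (‖h‖₊ ^ 2)) P

/-- `F` is (a version of) the process `t ↦ u(x,t) = ∫_{ℝ×[0,t]} p(x - y, t - r) W(dy × dr)`, where
`u` is the solution to the stochastic heat equation `∂ₜu = ½ ∂ₓ²u + Ẇ`, `u(·,0) = 0`. -/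
def IsHeatSolutionAt {Ω : Type*} [MeasurableSpace Ω] {P : Measure Ω} (W : WhiteNoise P)
    (x : ℝ) (F : ℝ → Ω → ℝ) : Prop :=
  ∀ t : ℝ, 0 ≤ t → F t =ᵐ[P] W.integral (heatL2 x t)

/-- The spatial derivative `∂ₓʲ g (x,t)`. -/
def partialX (g : ℝ → ℝ → ℝ) (j : ℕ) (x t : ℝ) : ℝ :=
  iteratedDeriv j (fun y => g y t) x

/-- The mixed derivative `∂ₜ ∂ₓʲ g (x,t)`. -/
def partialTX (g : ℝ → ℝ → ℝ) (j : ℕ) (x t : ℝ) : ℝ :=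
  deriv (fun s => partialX g j x s) t

/-- The class `C^{k,1}_r(ℝ × [0,∞))`. Only the values `g x t` with `t ≥ 0` matter. -/
structure IsCkr (k r : ℕ) (g : ℝ → ℝ → ℝ) : Prop where
  /-- `∂ₓʲ g` exists for `0 ≤ j ≤ k` (and is continuous in `x`) at each time `t ≥ 0`. -/
  contDiff_space : ∀ t : ℝ, 0 ≤ t → ContDiff ℝ k (fun y => g y t)
  /-- `∂ₓʲ g` is jointly continuous on `ℝ × [0,∞)` for `0 ≤ j ≤ k`; in particular `g` is. -/
  continuousOn_partialX : ∀ j ≤ k,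
    ContinuousOn (fun q : ℝ × ℝ => partialX g j q.1 q.2) (univ ×ˢ Ici 0)
  /-- `∂ₜ ∂ₓʲ g` exists on `ℝ × (0,∞)` for `0 ≤ j ≤ r`. -/
  differentiableAt_time : ∀ j ≤ r, ∀ x t : ℝ, 0 < t →
    DifferentiableAt ℝ (fun s => partialX g j x s) t
  /-- `∂ₜ ∂ₓʲ g` is continuous on `ℝ × (0,∞)` for `0 ≤ j ≤ r`. -/
  continuousOn_partialTX : ∀ j ≤ r,
    ContinuousOn (fun q : ℝ × ℝ => partialTX g j q.1 q.2) (univ ×ˢ Ioi 0)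
  /-- `limsup_{t → 0} sup_{x ∈ K} |∂ₜ ∂ₓʲ g (x,t)| < ∞` for every compact `K` and `0 ≤ j ≤ r`. -/
  bounded_partialTX : ∀ K : Set ℝ, IsCompact K → ∀ j ≤ r,
    ∃ M : ℝ, ∀ᶠ t in 𝓝[>] (0 : ℝ), ∀ x ∈ K, |partialTX g j x t| ≤ M

/-- The grid points `t_j = j / n`. -/
def gridTime (n j : ℕ) : ℝ := (j : ℝ) / (n : ℝ)

/-- The increment `ΔF_j = F(t_j) - F(t_{j-1})`, for `j ≥ 1`. -/
def increment {Ω : Type*} (F : ℝ → Ω → ℝ) (n j : ℕ) (ω : Ω) : ℝ :=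
  F (gridTime n j) ω - F (gridTime n (j - 1)) ω

/-- `∑_{j=c+1}^{d} {g(F(t_{j-1}), t_{j-1}) - g(F(t_c), t_c)} ΔF_j² (-1)^j`. -/
def alternatingSum {Ω : Type*} (g : ℝ → ℝ → ℝ) (F : ℝ → Ω → ℝ) (n c d : ℕ) (ω : Ω) : ℝ :=
  ∑ j ∈ Finset.Icc (c + 1) d,
    (g (F (gridTime n (j - 1)) ω) (gridTime n (j - 1)) - g (F (gridTime n c) ω) (gridTime n c))
      * increment F n j ω ^ 2 * (-1) ^ j

end QuarticHeat

end

/-!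
Write `φ_j = g(F(t_j), t_j) - g(F(t_c), t_c)`, let `σ_j²` be the variance of the increment
`X_j = F(t_{j+1}) - F(t_j)`, let `δ² = 1/n` be the mesh, `N = d - c` and `τ = t_d - t_c = N δ²`. Up to
sign, the alternating sum is `Q + R` with `Q = ∑ (-1)^j φ_j (X_j² - σ_j²)` and
`R = ∑ (-1)^j φ_j σ_j²`.

The explicit covariance `E[F(s) F(t)] = (√(t + s) - √|t - s|) / √(2π)` (`inner_heatL2`) gives three
facts: increments are nearly uncorrelated, `∑_j |E[X_i X_j]| ≤ 5 δ` (`sum_abs_inner_stepL2_le`);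
`|E[X_i F(t_k)]| ≤ 2 δ` for all `i, k`; and `∑ |σ_{j+1}² - σ_j²| ≤ 2 δ`. All of them come from
telescoping sums of second differences of the square root. Moreover
`E[(F(t) - F(s))²] ≤ 2 √(t - s)`, so `E[φ_j²]` is `O(√τ)`.

For `Q`, four Gaussian integrations by parts (`abs_integral_hermite_mul_hermite_sub_le`) show that
`E[φ_i φ_j (X_i² - σ_i²) (X_j² - σ_j²)]` is `2 E[X_i X_j]² E[φ_i φ_j]` up to terms of order
`|E[X_i X_j]| δ² + δ⁴`. Summed over `i` and `j`, this is of order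
`N δ² √τ + N δ³ + N² δ⁴`, hence of order `τ^(3/2)`.

For `R`, summation by parts (`two_mul_sum_alternating`) brings in the alternating signs: `2 R` is, up
to a boundary term and the variation of `σ_j²`, the sum of the `(-1)^j σ_{j+1}² (φ_{j+1} - φ_j)`. A
Taylor expansion turns `φ_{j+1} - φ_j` into `∂ₓg(F(t_j), t_j) X_j` plus an error `O(δ² + X_j²)`, which
is small enough to be summed in absolute value. The first order term is again treated by integration
by parts (`abs_integral_mul_mul_le`). These estimates are `abs_sum_alternating_mul_sq_le` and
`WhiteNoise.integral_alternating_sq_le`. They use `g` only through the boundedness of `∂ₓʲ g` for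
`j ≤ 4` and its Lipschitz continuity in time.
-/

noncomputable section

namespace QuarticHeat

open scoped RealInnerProductSpace

/-! ### Gaussian integration by parts -/

section

/-- One-dimensional Gaussian integration by parts: `E[X h(X)] = v E[h'(X)]` for `X ~ N(0, v)`, because
the Gaussian density `ρ` satisfies `ρ'(s) = -(s / v) ρ(s)`. -/
theorem integral_mul_gaussianReal_eq {v : ℝ≥0} (hv : v ≠ 0) {h h' : ℝ → ℝ}
    (hd : ∀ s, HasDerivAt h (h' s) s) (h1 : Integrable h (gaussianReal 0 v))
    (h2 : Integrable h' (gaussianReal 0 v))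
    (h3 : Integrable (fun s => s * h s) (gaussianReal 0 v)) :
    ∫ s, s * h s ∂(gaussianReal 0 v) = v * ∫ s, h' s ∂(gaussianReal 0 v) := by
  have hv' : (v : ℝ) ≠ 0 := by exact_mod_cast hv
  have key : ∀ f : ℝ → ℝ, Integrable f (gaussianReal 0 v) →
      Integrable (fun s => gaussianPDFReal 0 v s * f s) := by
    intro f hf
    rw [gaussianReal_of_var_ne_zero 0 hv, integrable_withDensity_iff_integrable_smul'
      (measurable_gaussianPDF 0 v) (ae_of_all _ fun _ => gaussianPDF_lt_top)] at hf
    simpa [toReal_gaussianPDF] using hf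
  have hpdf : ∀ s, HasDerivAt (gaussianPDFReal 0 v) (-(s / v) * gaussianPDFReal 0 v s) s := by
    intro s
    have h0 : HasDerivAt (fun y : ℝ => -(y - 0) ^ 2 / (2 * (v : ℝ))) (-(s / v)) s := by
      have := (((hasDerivAt_id' s).sub_const 0).fun_pow 2).fun_neg.div_const (2 * (v : ℝ))
      refine this.congr_deriv ?_
      simp
      field_simp
    have h4 := h0.exp.const_mul (√(2 * Real.pi * v))⁻¹
    rw [gaussianPDFReal_def]
    refine h4.congr_deriv ?_
    ring
  have hI := integral_eq_zero_of_hasDerivAt_of_integrable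
    (f := fun s => gaussianPDFReal 0 v s * h s)
    (f' := fun s => -(s / v) * gaussianPDFReal 0 v s * h s + gaussianPDFReal 0 v s * h' s)
    (fun s => (hpdf s).mul (hd s)) ?_ (key _ h1)
  · rw [integral_gaussianReal_eq_integral_smul hv, integral_gaussianReal_eq_integral_smul hv]
    simp only [smul_eq_mul]
    have e : ∀ s, -(s / v) * gaussianPDFReal 0 v s * h s
        = (-(v : ℝ)⁻¹) * (gaussianPDFReal 0 v s * (s * h s)) := fun s => by
      field_simp
    simp_rw [e] at hI
    rw [integral_add ((key _ h3).const_mul _) (key _ h2), integral_const_mul] at hI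
    rw [neg_mul, neg_add_eq_zero, inv_mul_eq_iff_eq_mul₀ hv'] at hI
    exact hI
  · refine Integrable.add ?_ (key _ h2)
    refine ((key _ h3).const_mul (-(v : ℝ)⁻¹)).congr (Eventually.of_forall fun s => ?_)
    simp only
    field_simp

/-- Polynomial growth of a real function on a normed space, with the weight `(1 + ‖w‖) ^ m`; it makes
the function integrable against every Gaussian measure. -/
def PolyGrowth {E : Type*} [NormedAddCommGroup E] (f : E → ℝ) : Prop :=
  ∃ (K : ℝ) (m : ℕ), ∀ w, |f w| ≤ K * (1 + ‖w‖) ^ m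

namespace PolyGrowth

variable {E : Type*} [NormedAddCommGroup E] {f g : E → ℝ}

theorem exists_nonneg (hf : PolyGrowth f) :
    ∃ (K : ℝ) (m : ℕ), 0 ≤ K ∧ ∀ w, |f w| ≤ K * (1 + ‖w‖) ^ m := by
  obtain ⟨K, m, h⟩ := hf
  refine ⟨|K|, m, abs_nonneg _, fun w => (h w).trans ?_⟩
  gcongr
  exact le_abs_self K

theorem of_bounded (K : ℝ) (h : ∀ w, |f w| ≤ K) : PolyGrowth f := ⟨K, 0, by simpa using h⟩

theorem mul (hf : PolyGrowth f) (hg : PolyGrowth g) : PolyGrowth (fun w => f w * g w) := by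
  obtain ⟨K, m, hK, h⟩ := hf.exists_nonneg
  obtain ⟨K', m', hK', h'⟩ := hg.exists_nonneg
  refine ⟨K * K', m + m', fun w => ?_⟩
  rw [abs_mul, pow_add]
  calc |f w| * |g w| ≤ (K * (1 + ‖w‖) ^ m) * (K' * (1 + ‖w‖) ^ m') := by
        gcongr
        exacts [h w, h' w]
    _ = _ := by ring

theorem add (hf : PolyGrowth f) (hg : PolyGrowth g) : PolyGrowth (fun w => f w + g w) := by
  obtain ⟨K, m, hK, h⟩ := hf.exists_nonneg
  obtain ⟨K', m', hK', h'⟩ := hg.exists_nonneg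
  refine ⟨K + K', m + m', fun w => (abs_add_le _ _).trans ?_⟩
  have h1 : (1 : ℝ) ≤ 1 + ‖w‖ := by linarith [norm_nonneg w]
  rw [add_mul]
  gcongr
  · exact (h w).trans (by gcongr; omega)
  · exact (h' w).trans (by gcongr; omega)

theorem pow (hf : PolyGrowth f) (n : ℕ) : PolyGrowth (fun w => f w ^ n) := by
  induction n with
  | zero => exact of_bounded 1 (by simp)
  | succ n ih => simpa [pow_succ] using ih.mul hf

theorem integrable {Ω : Type*} [MeasurableSpace Ω] {P : Measure Ω} [IsProbabilityMeasure P]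
    (hf : PolyGrowth f) (hc : Continuous f) {Y : Ω → E}
    (hY : ∀ p : ℝ≥0∞, p ≠ ∞ → MemLp Y p P) : Integrable (fun ω => f (Y ω)) P := by
  obtain ⟨K, m, hK, h⟩ := hf.exists_nonneg
  have h1 : Integrable (fun ω => (1 + ‖Y ω‖) ^ m) P := by
    have h0 : MemLp (fun _ : Ω => (1 : ℝ)) m P := memLp_const (1 : ℝ)
    have h2 : MemLp (fun ω => 1 + ‖Y ω‖) m P := h0.add (hY m (by simp)).norm
    refine h2.integrable_norm_pow'.congr (Eventually.of_forall fun ω => ?_)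
    have : 0 ≤ 1 + ‖Y ω‖ := by positivity
    simp only [Real.norm_eq_abs, abs_of_nonneg this]
  refine (h1.const_mul K).mono'
    (hc.comp_aestronglyMeasurable (hY 0 (by simp)).aestronglyMeasurable) ?_
  exact Eventually.of_forall fun ω => by simpa using h _

end PolyGrowth

variable {Ω : Type*} [MeasurableSpace Ω] {P : Measure Ω}

namespace WhiteNoise

variable (W : WhiteNoise P)

theorem integral_add_ae (h k : SpaceTimeL2) :
    W.integral (h + k) =ᵐ[P] fun ω => W.integral h ω + W.integral k ω := by
  rw [map_add]; exact Lp.coeFn_add _ _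

theorem integral_sub_ae (h k : SpaceTimeL2) :
    W.integral (h - k) =ᵐ[P] fun ω => W.integral h ω - W.integral k ω := by
  rw [map_sub]; exact Lp.coeFn_sub _ _

theorem integral_smul_ae (c : ℝ) (h : SpaceTimeL2) :
    W.integral (c • h) =ᵐ[P] fun ω => c * W.integral h ω := by
  rw [map_smul]; exact Lp.coeFn_smul _ _

theorem integral_sum_ae {ι : Type*} (s : Finset ι) (h : ι → SpaceTimeL2) :
    W.integral (∑ k ∈ s, h k) =ᵐ[P] fun ω => ∑ k ∈ s, W.integral (h k) ω := by
  classical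
  induction s using Finset.induction_on with
  | empty =>
    simp only [Finset.sum_empty, map_zero]
    exact Lp.coeFn_zero _ _ _
  | insert a s ha ih =>
    simp only [Finset.sum_insert ha]
    filter_upwards [W.integral_add_ae (h a) (∑ k ∈ s, h k), ih] with ω h1 h2
    rw [h1, h2]

theorem memLp_integral (h : SpaceTimeL2) (p : ℝ≥0∞) (hp : p ≠ ∞) :
    MemLp (W.integral h) p P :=
  (W.hasLaw_integral h).hasGaussianLaw.memLp hp

theorem integral_integral_eq_zero (h : SpaceTimeL2) : ∫ ω, W.integral h ω ∂P = 0 := by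
  rw [(W.hasLaw_integral h).integral_eq]
  simp

/-- Wiener integrals are jointly Gaussian: by linearity every linear combination of them is again a
Wiener integral. -/
theorem hasGaussianLaw_prodMk {ι : Type*} [Fintype ι] (x : SpaceTimeL2) (z : ι → SpaceTimeL2) :
    HasGaussianLaw (fun ω => (W.integral x ω, fun k => W.integral (z k) ω)) P := by
  classical
  have hm : AEMeasurable (fun ω => (W.integral x ω, fun k => W.integral (z k) ω)) P :=
    (W.hasLaw_integral x).aemeasurable.prodMk
      (aemeasurable_pi_lambda _ fun k => (W.hasLaw_integral (z k)).aemeasurable)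
  refine ⟨isGaussian_of_map_eq_gaussianReal fun L => ?_⟩
  set l : SpaceTimeL2 := L (1, 0) • x + ∑ k, L (0, Pi.single k 1) • z k
  refine ⟨0, ‖l‖₊ ^ 2, ?_⟩
  rw [AEMeasurable.map_map_of_aemeasurable (by fun_prop) hm, ← (W.hasLaw_integral l).map_eq]
  refine Measure.map_congr ?_
  have hs : ∀ᵐ ω ∂P, ∀ k, W.integral (L (0, Pi.single k 1) • z k) ω
      = L (0, Pi.single k 1) * W.integral (z k) ω :=
    ae_all_iff.2 fun k => W.integral_smul_ae _ _
  filter_upwards [W.integral_add_ae (L (1, 0) • x) (∑ k, L (0, Pi.single k 1) • z k),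
    W.integral_smul_ae (L (1, 0)) x,
    W.integral_sum_ae Finset.univ (fun k => L (0, Pi.single k 1) • z k), hs] with ω h1 h2 h3 h4
  rw [h1, h2, h3]
  simp only [h4, Function.comp]
  have : ((W.integral x ω, fun k => W.integral (z k) ω) : ℝ × (ι → ℝ))
      = W.integral x ω • ((1 : ℝ), (0 : ι → ℝ))
        + ∑ k, W.integral (z k) ω • ((0 : ℝ), (Pi.single k (1 : ℝ) : ι → ℝ)) := by
    ext i
    · simp [Prod.fst_sum]
    · simp [Prod.snd_sum, Finset.sum_apply, Pi.single_apply]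
  rw [this, map_add, map_smul, map_sum]
  simp only [map_smul, smul_eq_mul, mul_comm]

theorem memLp_pi {ι : Type*} [Fintype ι] (z : ι → SpaceTimeL2) (p : ℝ≥0∞) (hp : p ≠ ∞) :
    MemLp (fun ω k => W.integral (z k) ω) p P :=
  (W.hasGaussianLaw_prodMk 0 z).snd.memLp hp

variable [IsProbabilityMeasure P]

theorem integral_sq (h : SpaceTimeL2) : ∫ ω, W.integral h ω ^ 2 ∂P = ‖h‖ ^ 2 := by
  have h1 := (W.hasLaw_integral h).variance_eq
  rw [variance_eq_sub (W.memLp_integral h 2 (by simp)), variance_id_gaussianReal,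
    W.integral_integral_eq_zero] at h1
  simpa using h1

/-- The isometry property, by polarization of the variance. -/
theorem integral_mul (h k : SpaceTimeL2) :
    ∫ ω, W.integral h ω * W.integral k ω ∂P = ⟪h, k⟫ := by
  have e := W.integral_sq (h + k)
  have e1 : ∫ ω, W.integral (h + k) ω ^ 2 ∂P = ∫ ω, (W.integral h ω ^ 2
      + 2 * (W.integral h ω * W.integral k ω) + W.integral k ω ^ 2) ∂P := by
    refine integral_congr_ae ?_
    filter_upwards [W.integral_add_ae h k] with ω h1
    rw [h1]; ring
  have m1 := W.memLp_integral h 2 (by simp)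
  have m2 := W.memLp_integral k 2 (by simp)
  have m3 : Integrable (fun ω => W.integral h ω * W.integral k ω) P := m1.integrable_mul m2
  rw [e1, integral_add (by exact m1.integrable_sq.add (m3.const_mul 2)) m2.integrable_sq,
    integral_add m1.integrable_sq (m3.const_mul 2), integral_const_mul, W.integral_sq,
    W.integral_sq, norm_add_sq_real] at e
  linarith

/-- Gaussian integration by parts: for a Gaussian vector `Y = (∫ y_k dW)_k` and `X = ∫ x dW`,
`E[X f(Y)]` is the expectation of the derivative `f'` of `f` in the direction `(E[X Y_k])_k`.
The proof writes `Y = X b + Z` with `Z` independent of `X`, and integrates by parts in `X` for fixed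
`Z`. -/
theorem integral_mul_comp_eq {ι : Type*} [Fintype ι] (x : SpaceTimeL2) (y : ι → SpaceTimeL2)
    {f f' : (ι → ℝ) → ℝ} (hf : Continuous f) (hf' : Continuous f')
    (gf : PolyGrowth f) (gf' : PolyGrowth f')
    (hd : ∀ w : ι → ℝ, HasDerivAt (fun s : ℝ => f (w + s • fun k => ⟪x, y k⟫)) (f' w) 0) :
    ∫ ω, W.integral x ω * f (fun k => W.integral (y k) ω) ∂P
      = ∫ ω, f' (fun k => W.integral (y k) ω) ∂P := by
  set c : ι → ℝ := fun k => ⟪x, y k⟫ with hc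
  have hd' : ∀ (w : ι → ℝ) (s : ℝ), HasDerivAt (fun s : ℝ => f (w + s • c)) (f' (w + s • c)) s := by
    intro w s
    have h := (hd (w + s • c)).scomp_of_eq s ((hasDerivAt_id s).sub_const s) (by simp)
    simp only [one_smul, Function.comp_def, id] at h
    refine h.congr_of_eventuallyEq (Eventually.of_forall fun t => ?_)
    simp only
    congr 1
    module
  -- For `x = 0` the regression on `X` is not defined, but both sides vanish.
  rcases eq_or_ne x 0 with rfl | hx
  · have hc0 : c = 0 := by ext; simp [hc]
    have hf0 : ∀ w, f' w = 0 := fun w => by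
      have := hd w
      rw [hc0] at this
      simpa using! this.unique (by simpa using hasDerivAt_const (0 : ℝ) (f w))
    simp only [hf0, integral_zero]
    rw [← integral_zero Ω ℝ (μ := P)]
    refine integral_congr_ae ?_
    have : W.integral (0 : SpaceTimeL2) =ᵐ[P] 0 := by rw [map_zero]; exact Lp.coeFn_zero _ _ _
    filter_upwards [this] with ω h
    rw [h, Pi.zero_apply, zero_mul]
  set v : ℝ≥0 := ‖x‖₊ ^ 2 with hvdef
  have hv : v ≠ 0 := by simp [hvdef, hx]
  have hvr : (v : ℝ) = ‖x‖ ^ 2 := by simp [hvdef]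
  have hv' : (v : ℝ) ≠ 0 := by exact_mod_cast hv
  -- `z k` is the part of `y k` orthogonal to `x`, so that `Z` is independent of `X`.
  set b : ι → ℝ := fun k => c k / v
  set z : ι → SpaceTimeL2 := fun k => y k - b k • x
  have hYae : ∀ᵐ ω ∂P, (fun k => W.integral (y k) ω)
      = (fun k => W.integral (z k) ω) + W.integral x ω • b := by
    have h1 : ∀ᵐ ω ∂P, ∀ k, W.integral (z k) ω
        = W.integral (y k) ω - W.integral (b k • x) ω :=
      ae_all_iff.2 fun k => W.integral_sub_ae _ _
    have h2 : ∀ᵐ ω ∂P, ∀ k, W.integral (b k • x) ω = b k * W.integral x ω :=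
      ae_all_iff.2 fun k => W.integral_smul_ae _ _
    filter_upwards [h1, h2] with ω h1 h2
    ext k
    simp only [h1, h2, Pi.add_apply, Pi.smul_apply, smul_eq_mul]; ring
  have hind : IndepFun (W.integral x) (fun ω k => W.integral (z k) ω) P := by
    have h := HasGaussianLaw.indepFun_of_covariance_eval (P := P)
      (X := fun (_ : Unit) => W.integral x)
      (Y := fun k => W.integral (z k)) ?_ ?_
    · exact h.comp (φ := fun a : Unit → ℝ => a ()) (ψ := id) (measurable_pi_apply ()) measurable_id
    · exact (W.hasGaussianLaw_prodMk x z).map_fun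
        (((ContinuousLinearMap.pi fun _ => ContinuousLinearMap.fst ℝ ℝ (ι → ℝ)).prod
          (ContinuousLinearMap.snd ℝ ℝ (ι → ℝ)) :
            ℝ × (ι → ℝ) →L[ℝ] (Unit → ℝ) × (ι → ℝ)))
    · intro _ k
      rw [covariance_eq_sub (W.memLp_integral _ 2 (by simp)) (W.memLp_integral _ 2 (by simp)),
        W.integral_integral_eq_zero, zero_mul, sub_zero]
      change ∫ ω, W.integral x ω * W.integral (z k) ω ∂P = 0
      rw [W.integral_mul, inner_sub_right, inner_smul_right, real_inner_self_eq_norm_sq, ← hvr]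
      simp only [b, hc]
      field_simp
      simp
  have mx := (W.hasLaw_integral x).aemeasurable
  have mz : AEMeasurable (fun ω k => W.integral (z k) ω) P :=
    aemeasurable_pi_lambda _ fun k => (W.hasLaw_integral (z k)).aemeasurable
  set ν := P.map (fun ω k => W.integral (z k) ω) with hν
  have hmap : P.map (fun ω => (W.integral x ω, fun k => W.integral (z k) ω))
      = (gaussianReal 0 v).prod ν := by
    rw [(indepFun_iff_map_prod_eq_prod_map_map mx mz).1 hind, (W.hasLaw_integral x).map_eq]
  have hpν : IsProbabilityMeasure ν := Measure.isProbabilityMeasure_map mz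
  have hMem : ∀ p : ℝ≥0∞, p ≠ ∞ →
      MemLp (id : ℝ × (ι → ℝ) → ℝ × (ι → ℝ)) p ((gaussianReal 0 v).prod ν) := by
    intro p hp
    rw [← hmap, memLp_map_measure_iff aestronglyMeasurable_id (mx.prodMk mz)]
    exact (W.hasGaussianLaw_prodMk x z).memLp hp
  have hcomp : ∀ {F : (ι → ℝ) → ℝ}, PolyGrowth F →
      PolyGrowth (fun q : ℝ × (ι → ℝ) => F (q.2 + q.1 • b)) := by
    intro F hF
    obtain ⟨K, m, hK, h⟩ := hF.exists_nonneg
    refine ⟨K * (1 + ‖b‖) ^ m, m, fun q => (h _).trans ?_⟩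
    rw [mul_assoc, ← mul_pow]
    gcongr
    calc 1 + ‖q.2 + q.1 • b‖ ≤ 1 + (‖q.2‖ + ‖q.1‖ * ‖b‖) := by
          gcongr; exact (norm_add_le _ _).trans (by rw [norm_smul])
      _ ≤ 1 + (‖q‖ + ‖q‖ * ‖b‖) := by
          gcongr
          exacts [norm_snd_le q, norm_fst_le q]
      _ ≤ (1 + ‖b‖) * (1 + ‖q‖) := by nlinarith [norm_nonneg b, norm_nonneg q]
  have hfst : PolyGrowth (fun q : ℝ × (ι → ℝ) => q.1) :=
    ⟨1, 1, fun q => by have := norm_fst_le q; simp at this ⊢; linarith⟩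
  have transfer : ∀ F : ℝ × (ι → ℝ) → ℝ, Continuous F →
      ∫ ω, F (W.integral x ω, fun k => W.integral (z k) ω) ∂P
        = ∫ q, F q ∂((gaussianReal 0 v).prod ν) := by
    intro F hF
    rw [← hmap, integral_map (mx.prodMk mz) hF.aestronglyMeasurable]
  have i1 : Integrable (fun q : ℝ × (ι → ℝ) => q.1 * f (q.2 + q.1 • b))
      ((gaussianReal 0 v).prod ν) :=
    (hfst.mul (hcomp gf)).integrable (by fun_prop) (Y := id) hMem
  have i2 : Integrable (fun q : ℝ × (ι → ℝ) => f' (q.2 + q.1 • b))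
      ((gaussianReal 0 v).prod ν) :=
    (hcomp gf').integrable (by fun_prop) (Y := id) hMem
  have hslice : ∀ {F : ℝ × (ι → ℝ) → ℝ}, PolyGrowth F → Continuous F → ∀ w,
      Integrable (fun s => F (s, w)) (gaussianReal 0 v) := by
    intro F hF hFc w
    refine hF.integrable hFc (Y := fun s => (s, w)) fun p hp => ?_
    have h1 : MemLp (fun s : ℝ => (s, (0 : ι → ℝ))) p (gaussianReal 0 v) :=
      ((ContinuousLinearMap.inl ℝ ℝ (ι → ℝ)).comp_memLp' (memLp_id_gaussianReal' p hp))
    have h2 : MemLp (fun _ : ℝ => ((0 : ℝ), w)) p (gaussianReal 0 v) := memLp_const _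
    refine (h1.add h2).ae_eq (Eventually.of_forall fun s => ?_)
    simp
  calc ∫ ω, W.integral x ω * f (fun k => W.integral (y k) ω) ∂P
      = ∫ ω, (fun q : ℝ × (ι → ℝ) => q.1 * f (q.2 + q.1 • b))
          (W.integral x ω, fun k => W.integral (z k) ω) ∂P := by
        refine integral_congr_ae ?_
        filter_upwards [hYae] with ω h
        rw [h]
    _ = ∫ w, ∫ s, s * f (w + s • b) ∂(gaussianReal 0 v) ∂ν := by
        rw [transfer (fun q => q.1 * f (q.2 + q.1 • b)) (by fun_prop), integral_prod_symm _ i1]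
    _ = ∫ w, ∫ s, f' (w + s • b) ∂(gaussianReal 0 v) ∂ν := by
        refine integral_congr_ae (Eventually.of_forall fun w => ?_)
        have hder : ∀ s, HasDerivAt (fun s : ℝ => f (w + s • b))
            ((v : ℝ)⁻¹ * f' (w + s • b)) s := by
          intro s
          have e : ∀ s : ℝ, s • b = (s / v) • c := fun s => by
            ext k; simp [b]; ring
          simp_rw [e]
          have h := (hd' w (s / v)).scomp s ((hasDerivAt_id s).div_const (v : ℝ))
          simpa [Function.comp_def] using h
        have h := integral_mul_gaussianReal_eq hv hder
          (hslice (hcomp gf) (by fun_prop) w)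
          ((hslice (hcomp gf') (by fun_prop) w).const_mul _)
          (hslice (hfst.mul (hcomp gf)) (by fun_prop) w)
        rw [integral_const_mul] at h
        simp only
        rw [h]
        field_simp
    _ = ∫ ω, (fun q : ℝ × (ι → ℝ) => f' (q.2 + q.1 • b))
          (W.integral x ω, fun k => W.integral (z k) ω) ∂P := by
        rw [transfer (fun q => f' (q.2 + q.1 • b)) (by fun_prop), integral_prod_symm _ i2]
    _ = _ := by
        refine integral_congr_ae ?_
        filter_upwards [hYae] with ω h
        rw [h]

end WhiteNoise

end

/-! ### Mixed moments of Gaussian variables -/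

section

variable {Ω : Type*} [MeasurableSpace Ω] {P : Measure Ω}

/-- `u 0, u 1, …, u N` are continuous, bounded by `K`, and each is the derivative of the
preceding one. The functions `u k` with `k > N` are arbitrary. -/
structure IsBoundedTower (N : ℕ) (K : ℝ) (u : ℕ → ℝ → ℝ) : Prop where
  continuous : ∀ k ≤ N, Continuous (u k)
  hasDerivAt : ∀ k < N, ∀ y, HasDerivAt (u k) (u (k + 1) y) y
  abs_le : ∀ k ≤ N, ∀ y, |u k y| ≤ K

theorem polyGrowth_eval {ι : Type*} [Fintype ι] (i : ι) : PolyGrowth (fun w : ι → ℝ => w i) :=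
  ⟨1, 1, fun w => by have := norm_le_pi_norm w i; simp at this ⊢; linarith⟩

theorem abs_mul_add_mul_le_two_mul {s t m n ε B : ℝ} (hs : |s| ≤ ε) (ht : |t| ≤ ε) (hm : |m| ≤ B)
    (hn : |n| ≤ B) : |s * m + t * n| ≤ 2 * ε * B := by
  have hε := (abs_nonneg _).trans hs
  calc |s * m + t * n| ≤ |s| * |m| + |t| * |n| := by
        rw [← abs_mul, ← abs_mul]; exact abs_add_le _ _
    _ ≤ ε * B + ε * B := by gcongr
    _ = 2 * ε * B := by ring

namespace WhiteNoise

variable (W : WhiteNoise P)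

/-- The mixed moment `E[A^p B^q u_k(Y) v_l(Z)]` of the Gaussian variables `A, B, Y, Z` that are
the Wiener integrals of `a, b, y, z`. -/
def mixedMoment (u v : ℕ → ℝ → ℝ) (a b y z : SpaceTimeL2) (p q k l : ℕ) : ℝ :=
  ∫ ω, W.integral a ω ^ p * W.integral b ω ^ q * u k (W.integral y ω) * v l (W.integral z ω) ∂P

variable {N : ℕ} {K L : ℝ} {u v : ℕ → ℝ → ℝ}

variable (u v) in
theorem mixedMoment_swap (a b y z : SpaceTimeL2) (p q k l : ℕ) :
    W.mixedMoment u v a b y z p q k l = W.mixedMoment u v b a y z q p k l := by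
  unfold mixedMoment
  refine integral_congr_ae (Eventually.of_forall fun ω => ?_)
  simp only
  ring

variable [IsProbabilityMeasure P]

theorem integrable_mixedMoment (hu : IsBoundedTower N K u) (hv : IsBoundedTower N L v)
    (a b y z : SpaceTimeL2) (p q : ℕ) {k l : ℕ} (hk : k ≤ N) (hl : l ≤ N) :
    Integrable (fun ω => W.integral a ω ^ p * W.integral b ω ^ q * u k (W.integral y ω)
      * v l (W.integral z ω)) P := by
  have huc := hu.continuous k hk
  have hvc := hv.continuous l hl
  have g : PolyGrowth (fun w : Fin 4 → ℝ => w 0 ^ p * w 1 ^ q * u k (w 2) * v l (w 3)) :=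
    ((((polyGrowth_eval 0).pow p).mul ((polyGrowth_eval 1).pow q)).mul
      (.of_bounded K fun w => hu.abs_le k hk _)).mul (.of_bounded L fun w => hv.abs_le l hl _)
  have := g.integrable (by fun_prop) (W.memLp_pi ![a, b, y, z])
  simpa using this

/-- Integration by parts for a mixed moment. The truncated exponents `p - 1` and `q - 1` are harmless,
since they come with the factors `p` and `q`. -/
theorem integral_mul_mixedMoment (hu : IsBoundedTower N K u) (hv : IsBoundedTower N L v)
    (x a b y z : SpaceTimeL2) (p q : ℕ) {k l : ℕ} (hk : k < N) (hl : l < N) :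
    ∫ ω, W.integral x ω * (W.integral a ω ^ p * W.integral b ω ^ q * u k (W.integral y ω)
      * v l (W.integral z ω)) ∂P
    = p * ⟪x, a⟫ * W.mixedMoment u v a b y z (p - 1) q k l
      + q * ⟪x, b⟫ * W.mixedMoment u v a b y z p (q - 1) k l
      + ⟪x, y⟫ * W.mixedMoment u v a b y z p q (k + 1) l
      + ⟪x, z⟫ * W.mixedMoment u v a b y z p q k (l + 1) := by
  have huc := hu.continuous k hk.le
  have hvc := hv.continuous l hl.le
  have huc' := hu.continuous (k + 1) hk
  have hvc' := hv.continuous (l + 1) hl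
  have gu : PolyGrowth (fun w : Fin 4 → ℝ => u k (w 2)) :=
    .of_bounded K fun w => hu.abs_le k hk.le _
  have gv : PolyGrowth (fun w : Fin 4 → ℝ => v l (w 3)) :=
    .of_bounded L fun w => hv.abs_le l hl.le _
  have gu' : PolyGrowth (fun w : Fin 4 → ℝ => u (k + 1) (w 2)) :=
    .of_bounded K fun w => hu.abs_le (k + 1) hk _
  have gv' : PolyGrowth (fun w : Fin 4 → ℝ => v (l + 1) (w 3)) :=
    .of_bounded L fun w => hv.abs_le (l + 1) hl _
  have g0 : ∀ n, PolyGrowth (fun w : Fin 4 → ℝ => w 0 ^ n) := (polyGrowth_eval 0).pow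
  have g1 : ∀ n, PolyGrowth (fun w : Fin 4 → ℝ => w 1 ^ n) := (polyGrowth_eval 1).pow
  have gc : ∀ c : ℝ, PolyGrowth (fun _ : Fin 4 → ℝ => c) := fun c =>
    .of_bounded |c| fun _ => le_rfl
  have h := W.integral_mul_comp_eq x ![a, b, y, z]
    (f := fun w => w 0 ^ p * w 1 ^ q * u k (w 2) * v l (w 3))
    (f' := fun w => p * ⟪x, a⟫ * (w 0 ^ (p - 1) * w 1 ^ q * u k (w 2) * v l (w 3))
      + q * ⟪x, b⟫ * (w 0 ^ p * w 1 ^ (q - 1) * u k (w 2) * v l (w 3))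
      + ⟪x, y⟫ * (w 0 ^ p * w 1 ^ q * u (k + 1) (w 2) * v l (w 3))
      + ⟪x, z⟫ * (w 0 ^ p * w 1 ^ q * u k (w 2) * v (l + 1) (w 3)))
    (by fun_prop) (by fun_prop) ((((g0 p).mul (g1 q)).mul gu).mul gv)
    (((((gc _).mul ((((g0 _).mul (g1 q)).mul gu).mul gv)).add
      ((gc _).mul ((((g0 p).mul (g1 _)).mul gu).mul gv))).add
      ((gc _).mul ((((g0 p).mul (g1 q)).mul gu').mul gv))).add
      ((gc _).mul ((((g0 p).mul (g1 q)).mul gu).mul gv'))) ?_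
  · simp only [Matrix.cons_val] at h
    rw [h]
    have I := fun p q {k l} hk hl =>
      W.integrable_mixedMoment hu hv a b y z p q (k := k) (l := l) hk hl
    have I1 := (I (p - 1) q hk.le hl.le).const_mul (p * ⟪x, a⟫)
    have I2 := (I p (q - 1) hk.le hl.le).const_mul (q * ⟪x, b⟫)
    have I3 := (I p q hk hl.le).const_mul ⟪x, y⟫
    have I4 := (I p q hk.le hl).const_mul ⟪x, z⟫
    rw [integral_add (by exact (I1.add I2).add I3) I4, integral_add (by exact I1.add I2) I3,
      integral_add I1 I2]
    simp only [integral_const_mul, mixedMoment]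
  · intro w
    have line : ∀ i : Fin 4, HasDerivAt
        (fun s : ℝ => (w + s • fun k => ⟪x, (![a, b, y, z] : Fin 4 → SpaceTimeL2) k⟫) i)
        ⟪x, (![a, b, y, z] : Fin 4 → SpaceTimeL2) i⟫ 0 := by
      intro i
      simpa using ((hasDerivAt_id (0 : ℝ)).mul_const
        ⟪x, (![a, b, y, z] : Fin 4 → SpaceTimeL2) i⟫).const_add (w i)
    have hU := (hu.hasDerivAt k hk (w 2)).comp_of_eq 0 (line 2) (by simp)
    have hV := (hv.hasDerivAt l hl (w 3)).comp_of_eq 0 (line 3) (by simp)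
    refine (((((line 0).fun_pow p).fun_mul ((line 1).fun_pow q)).fun_mul hU).fun_mul
      hV).congr_deriv ?_
    simp
    ring

theorem mixedMoment_succ_left (hu : IsBoundedTower N K u) (hv : IsBoundedTower N L v)
    (a b y z : SpaceTimeL2) (p q : ℕ) {k l : ℕ} (hk : k < N) (hl : l < N) :
    W.mixedMoment u v a b y z (p + 1) q k l
    = p * ⟪a, a⟫ * W.mixedMoment u v a b y z (p - 1) q k l
      + q * ⟪a, b⟫ * W.mixedMoment u v a b y z p (q - 1) k l
      + ⟪a, y⟫ * W.mixedMoment u v a b y z p q (k + 1) l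
      + ⟪a, z⟫ * W.mixedMoment u v a b y z p q k (l + 1) := by
  rw [← W.integral_mul_mixedMoment hu hv a a b y z p q hk hl, mixedMoment]
  refine integral_congr_ae (Eventually.of_forall fun ω => ?_)
  simp only
  ring

theorem mixedMoment_zero_succ (hu : IsBoundedTower N K u) (hv : IsBoundedTower N L v)
    (a b y z : SpaceTimeL2) (q : ℕ) {k l : ℕ} (hk : k < N) (hl : l < N) :
    W.mixedMoment u v a b y z 0 (q + 1) k l
    = q * ⟪b, b⟫ * W.mixedMoment u v a b y z 0 (q - 1) k l
      + ⟪b, y⟫ * W.mixedMoment u v a b y z 0 q (k + 1) l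
      + ⟪b, z⟫ * W.mixedMoment u v a b y z 0 q k (l + 1) := by
  rw [mixedMoment_swap, W.mixedMoment_succ_left hu hv b a y z q 0 hk hl]
  simp only [W.mixedMoment_swap u v b a]
  simp

theorem abs_mixedMoment_le (hu : IsBoundedTower N K u) (hv : IsBoundedTower N L v)
    (a b y z : SpaceTimeL2) {k l : ℕ} (hk : k ≤ N) (hl : l ≤ N) :
    |W.mixedMoment u v a b y z 0 0 k l| ≤ K * L := by
  have h := norm_integral_le_of_norm_le_const (μ := P) (C := K * L)
    (f := fun ω => W.integral a ω ^ 0 * W.integral b ω ^ 0 * u k (W.integral y ω)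
      * v l (W.integral z ω)) (Eventually.of_forall fun ω => by
        simp only [pow_zero, one_mul, norm_mul, Real.norm_eq_abs]
        have h1 := hu.abs_le k hk (W.integral y ω)
        have h2 := hv.abs_le l hl (W.integral z ω)
        have := (abs_nonneg _).trans h1
        gcongr)
  simpa [mixedMoment] using h

/-- Integrating `A` and `B` by parts in `E[u(Y) A v(Z) B]` leaves `E[A B] E[u(Y) v(Z)]` and four
terms, each carrying a product of two covariances of `A, B` with `Y, Z`. -/
theorem abs_integral_mul_mul_le (hu : IsBoundedTower 2 K u) (hv : IsBoundedTower 2 L v)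
    {a b y z : SpaceTimeL2} {ε : ℝ} (hay : |⟪a, y⟫| ≤ ε) (haz : |⟪a, z⟫| ≤ ε)
    (hby : |⟪b, y⟫| ≤ ε) (hbz : |⟪b, z⟫| ≤ ε) :
    |∫ ω, (u 0 (W.integral y ω) * W.integral a ω) * (v 0 (W.integral z ω) * W.integral b ω) ∂P|
      ≤ K * L * (|⟪a, b⟫| + 4 * ε ^ 2) := by
  have e : ∫ ω, (u 0 (W.integral y ω) * W.integral a ω)
      * (v 0 (W.integral z ω) * W.integral b ω) ∂P = W.mixedMoment u v a b y z 1 1 0 0 := by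
    refine integral_congr_ae (Eventually.of_forall fun ω => ?_)
    simp only
    ring
  have e1 := W.mixedMoment_succ_left hu hv a b y z 0 1 (k := 0) (l := 0) (by simp) (by simp)
  have e2 := W.mixedMoment_zero_succ hu hv a b y z 0 (k := 1) (l := 0) (by simp) (by simp)
  have e3 := W.mixedMoment_zero_succ hu hv a b y z 0 (k := 0) (l := 1) (by simp) (by simp)
  simp only [zero_add, Nat.reduceAdd] at e1 e2 e3
  rw [e, e1, e2, e3]
  have B : ∀ k l, k ≤ 2 → l ≤ 2 → |W.mixedMoment u v a b y z 0 0 k l| ≤ K * L :=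
    fun k l hk hl => W.abs_mixedMoment_le hu hv a b y z hk hl
  have hε : 0 ≤ ε := (abs_nonneg _).trans hay
  have T : ∀ (s t : ℝ) k l, k ≤ 2 → l ≤ 2 → |s| ≤ ε → |t| ≤ ε →
      |s * (t * W.mixedMoment u v a b y z 0 0 k l)| ≤ K * L * ε ^ 2 := by
    intro s t k l hk hl hs ht
    have := B k l hk hl
    rw [abs_mul, abs_mul]
    calc |s| * (|t| * |W.mixedMoment u v a b y z 0 0 k l|) ≤ ε * (ε * (K * L)) := by gcongr
      _ = _ := by ring
  have t0 : |⟪a, b⟫ * W.mixedMoment u v a b y z 0 0 0 0| ≤ K * L * |⟪a, b⟫| := by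
    rw [abs_mul, mul_comm]
    gcongr
    exact B 0 0 (by simp) (by simp)
  have t1 := T _ _ 2 0 (by simp) (by simp) hay hby
  have t2 := T _ _ 1 1 (by simp) (by simp) hay hbz
  have t3 := T _ _ 1 1 (by simp) (by simp) haz hby
  have t4 := T _ _ 0 2 (by simp) (by simp) haz hbz
  simp only [abs_le] at t0 t1 t2 t3 t4 ⊢
  push_cast
  constructor <;> linarith [t0.1, t1.1, t2.1, t3.1, t4.1, t0.2, t1.2, t2.2, t3.2, t4.2]

/-- If `A, B` were independent of `Y, Z`, then `E[u(Y) v(Z) (A² - E A²) (B² - E B²)]` would be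
`2 E[A B]² E[u(Y) v(Z)]`. Four integrations by parts show that the error is controlled by the
covariances of `A, B` with `Y, Z`: it carries two of them and a factor `E[A B]`, or four. -/
theorem abs_integral_hermite_mul_hermite_sub_le (hu : IsBoundedTower 4 K u)
    (hv : IsBoundedTower 4 L v) {a b y z : SpaceTimeL2} {ε : ℝ} (hay : |⟪a, y⟫| ≤ ε)
    (haz : |⟪a, z⟫| ≤ ε) (hby : |⟪b, y⟫| ≤ ε) (hbz : |⟪b, z⟫| ≤ ε) :
    |∫ ω, u 0 (W.integral y ω) * v 0 (W.integral z ω) * (W.integral a ω ^ 2 - ‖a‖ ^ 2)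
        * (W.integral b ω ^ 2 - ‖b‖ ^ 2) ∂P
      - 2 * ⟪a, b⟫ ^ 2 * ∫ ω, u 0 (W.integral y ω) * v 0 (W.integral z ω) ∂P|
      ≤ 16 * (K * L) * (|⟪a, b⟫| * ε ^ 2 + ε ^ 4) := by
  have I := fun p q => W.integrable_mixedMoment hu hv a b y z p q (k := 0) (l := 0)
    (by simp) (by simp)
  set M := W.mixedMoment u v a b y z with hM
  have e : ∫ ω, u 0 (W.integral y ω) * v 0 (W.integral z ω) * (W.integral a ω ^ 2 - ‖a‖ ^ 2)
        * (W.integral b ω ^ 2 - ‖b‖ ^ 2) ∂P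
      = M 2 2 0 0 - ‖b‖ ^ 2 * M 2 0 0 0 - ‖a‖ ^ 2 * M 0 2 0 0 + ‖a‖ ^ 2 * ‖b‖ ^ 2 * M 0 0 0 0 := by
    simp only [hM, mixedMoment]
    rw [← integral_const_mul, ← integral_const_mul, ← integral_const_mul,
      ← integral_sub (I 2 2) ((I 2 0).const_mul _),
      ← integral_sub (by exact (I 2 2).sub ((I 2 0).const_mul _)) ((I 0 2).const_mul _),
      ← integral_add
        (by exact ((I 2 2).sub ((I 2 0).const_mul _)).sub ((I 0 2).const_mul _))
        ((I 0 0).const_mul _)]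
    refine integral_congr_ae (Eventually.of_forall fun ω => ?_)
    simp only
    ring
  have e' : ∫ ω, u 0 (W.integral y ω) * v 0 (W.integral z ω) ∂P = M 0 0 0 0 := by
    simp [hM, mixedMoment]
  have sl := fun p q k l (hk : k < 4) (hl : l < 4) =>
    W.mixedMoment_succ_left hu hv a b y z p q (k := k) (l := l) hk hl
  have sr := fun q k l (hk : k < 4) (hl : l < 4) =>
    W.mixedMoment_zero_succ hu hv a b y z q (k := k) (l := l) hk hl
  simp only [← hM] at sl sr
  have r0 : M 2 2 0 0 = ‖a‖ ^ 2 * M 0 2 0 0 + 2 * ⟪a, b⟫ * M 1 1 0 0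
      + ⟪a, y⟫ * M 1 2 1 0 + ⟪a, z⟫ * M 1 2 0 1 := by
    have := sl 1 2 0 0 (by simp) (by simp)
    simpa using this
  have r0' : M 2 0 0 0 = ‖a‖ ^ 2 * M 0 0 0 0 + ⟪a, y⟫ * M 1 0 1 0 + ⟪a, z⟫ * M 1 0 0 1 := by
    have := sl 1 0 0 0 (by simp) (by simp)
    simpa using this
  have r1 : ∀ k l, k < 4 → l < 4 → M 1 2 k l = 2 * ⟪a, b⟫ * M 0 1 k l + ⟪a, y⟫ * M 0 2 (k + 1) l
      + ⟪a, z⟫ * M 0 2 k (l + 1) := fun k l hk hl => by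
    have := sl 0 2 k l hk hl
    simpa using this
  have r2 : ∀ k l, k < 4 → l < 4 → M 1 0 k l = ⟪a, y⟫ * M 0 0 (k + 1) l
      + ⟪a, z⟫ * M 0 0 k (l + 1) := fun k l hk hl => by
    have := sl 0 0 k l hk hl
    simpa using this
  have r3 : M 1 1 0 0 = ⟪a, b⟫ * M 0 0 0 0 + ⟪a, y⟫ * M 0 1 1 0 + ⟪a, z⟫ * M 0 1 0 1 := by
    have := sl 0 1 0 0 (by simp) (by simp)
    simpa using this
  have r4 : ∀ k l, k < 4 → l < 4 → M 0 2 k l = ‖b‖ ^ 2 * M 0 0 k l + ⟪b, y⟫ * M 0 1 (k + 1) l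
      + ⟪b, z⟫ * M 0 1 k (l + 1) := fun k l hk hl => by
    have := sr 1 k l hk hl
    simpa using this
  have r5 : ∀ k l, k < 4 → l < 4 → M 0 1 k l = ⟪b, y⟫ * M 0 0 (k + 1) l
      + ⟪b, z⟫ * M 0 0 k (l + 1) := fun k l hk hl => by
    have := sr 0 k l hk hl
    simpa using this
  have hε : 0 ≤ ε := (abs_nonneg _).trans hay
  have B : ∀ k l, k ≤ 4 → l ≤ 4 → |M 0 0 k l| ≤ K * L :=
    fun k l hk hl => W.abs_mixedMoment_le hu hv a b y z hk hl
  -- The remainders, each bounded by the covariances of `a, b` with `y, z` that they carry.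
  have b01 : ∀ k l, k < 4 → l < 4 → |M 0 1 k l| ≤ 2 * ε * (K * L) := fun k l hk hl => by
    rw [r5 k l hk hl]
    refine (abs_mul_add_mul_le_two_mul hby hbz (B (k + 1) l hk hl.le) (B k (l + 1) hk.le hl)).trans_eq ?_
    ring
  have b02 : ∀ k l, k < 3 → l < 3 → |M 0 2 k l - ‖b‖ ^ 2 * M 0 0 k l| ≤ 4 * ε ^ 2 * (K * L) :=
    fun k l hk hl => by
      rw [r4 k l (by omega) (by omega), add_assoc, add_sub_cancel_left]
      refine (abs_mul_add_mul_le_two_mul hby hbz (b01 (k + 1) l (by omega) (by omega))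
        (b01 k (l + 1) (by omega) (by omega))).trans_eq ?_
      ring
  have b12 : ∀ k l, k < 2 → l < 2 → |M 1 2 k l - ‖b‖ ^ 2 * M 1 0 k l|
      ≤ (4 * |⟪a, b⟫| * ε + 8 * ε ^ 3) * (K * L) := fun k l hk hl => by
    have h1 : M 1 2 k l - ‖b‖ ^ 2 * M 1 0 k l = 2 * ⟪a, b⟫ * M 0 1 k l
        + (⟪a, y⟫ * (M 0 2 (k + 1) l - ‖b‖ ^ 2 * M 0 0 (k + 1) l)
          + ⟪a, z⟫ * (M 0 2 k (l + 1) - ‖b‖ ^ 2 * M 0 0 k (l + 1))) := by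
      rw [r1 k l (by omega) (by omega), r2 k l (by omega) (by omega)]
      ring
    have h2 := abs_mul_add_mul_le_two_mul hay haz (b02 (k + 1) l (by omega) (by omega))
      (b02 k (l + 1) (by omega) (by omega))
    have h3 : |2 * ⟪a, b⟫ * M 0 1 k l| ≤ 2 * |⟪a, b⟫| * (2 * ε * (K * L)) := by
      rw [abs_mul, abs_mul, abs_two]
      gcongr
      exact b01 k l (by omega) (by omega)
    rw [h1]
    refine (abs_add_le _ _).trans ((add_le_add h3 h2).trans_eq ?_)
    ring
  have h1 : M 2 2 0 0 - ‖b‖ ^ 2 * M 2 0 0 0 - ‖a‖ ^ 2 * M 0 2 0 0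
      + ‖a‖ ^ 2 * ‖b‖ ^ 2 * M 0 0 0 0 - 2 * ⟪a, b⟫ ^ 2 * M 0 0 0 0
      = 2 * ⟪a, b⟫ * (⟪a, y⟫ * M 0 1 1 0 + ⟪a, z⟫ * M 0 1 0 1)
        + (⟪a, y⟫ * (M 1 2 1 0 - ‖b‖ ^ 2 * M 1 0 1 0)
          + ⟪a, z⟫ * (M 1 2 0 1 - ‖b‖ ^ 2 * M 1 0 0 1)) := by
    rw [r0, r0', r3]
    ring
  have h2 := abs_mul_add_mul_le_two_mul hay haz (b12 1 0 (by simp) (by simp)) (b12 0 1 (by simp) (by simp))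
  have h3 : |2 * ⟪a, b⟫ * (⟪a, y⟫ * M 0 1 1 0 + ⟪a, z⟫ * M 0 1 0 1)|
      ≤ 2 * |⟪a, b⟫| * (2 * ε * (2 * ε * (K * L))) := by
    rw [abs_mul, abs_mul, abs_two]
    gcongr
    exact abs_mul_add_mul_le_two_mul hay haz (b01 1 0 (by simp) (by simp)) (b01 0 1 (by simp) (by simp))
  rw [e, e', h1]
  refine (abs_add_le _ _).trans ((add_le_add h3 h2).trans_eq ?_)
  ring

end WhiteNoise

end

/-! ### The covariance of the solution -/

/-- The semigroup property of the heat kernel on the diagonal, `∫ p(x-y,a) p(x-y,b) dy = p(0,a+b)`. -/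
theorem integral_heatKernel_mul {a b : ℝ} (ha : 0 < a) (hb : 0 < b) (x : ℝ) :
    ∫ y, heatKernel (x - y) a * heatKernel (x - y) b = (√(2 * Real.pi * (a + b)))⁻¹ := by
  have hπ := Real.pi_pos
  have h : ∀ y, heatKernel (x - y) a * heatKernel (x - y) b
      = ((√(2 * Real.pi * a))⁻¹ * (√(2 * Real.pi * b))⁻¹)
        * Real.exp (-((a + b) / (2 * a * b)) * (y - x) ^ 2) := by
    intro y
    unfold heatKernel
    rw [mul_mul_mul_comm, ← Real.exp_add]
    congr 2
    field_simp
    ring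
  simp_rw [h]
  rw [integral_const_mul, integral_sub_right_eq_self
    (fun y : ℝ => Real.exp (-((a + b) / (2 * a * b)) * y ^ 2)) x, integral_gaussian,
    ← Real.sqrt_inv, ← Real.sqrt_inv, ← Real.sqrt_inv, ← Real.sqrt_mul (by positivity),
    ← Real.sqrt_mul (by positivity)]
  congr 1
  field_simp

theorem integral_inv_sqrt_sub {s t : ℝ} (hs : 0 ≤ s) (hst : s ≤ t) :
    ∫ r in (0 : ℝ)..s, (√(2 * Real.pi * (s + t - 2 * r)))⁻¹
      = (√(2 * Real.pi))⁻¹ * (√(t + s) - √(t - s)) := by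
  have hπ := Real.pi_pos
  have hder : ∀ r ∈ Ioo 0 s, HasDerivAt (fun r => -((√(2 * Real.pi))⁻¹ * √(s + t - 2 * r)))
      ((√(2 * Real.pi * (s + t - 2 * r)))⁻¹) r := by
    intro r hr
    have hpos : 0 < s + t - 2 * r := by linarith [hr.2]
    have h1 : HasDerivAt (fun r : ℝ => s + t - 2 * r) (-2) r := by
      simpa using ((hasDerivAt_id r).const_mul 2).const_sub (s + t)
    refine ((h1.sqrt hpos.ne').const_mul ((√(2 * Real.pi))⁻¹)).neg.congr_deriv ?_
    rw [Real.sqrt_mul (by positivity) (s + t - 2 * r)]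
    field_simp
  have hcont : ContinuousOn (fun r => -((√(2 * Real.pi))⁻¹ * √(s + t - 2 * r))) (Icc 0 s) := by
    fun_prop
  rw [intervalIntegral.integral_eq_sub_of_hasDerivAt_of_le hs hcont hder]
  · rw [show s + t - 2 * s = t - s by ring, show s + t - 2 * 0 = t + s by ring]
    ring
  · rw [intervalIntegrable_iff_integrableOn_Ioc_of_le hs]
    exact intervalIntegral.integrableOn_deriv_of_nonneg hcont hder fun r _ => by positivity

/-- The covariance of `F(s)` and `F(t)`. -/
theorem inner_heatL2 (x : ℝ) {s t : ℝ} (hs : 0 ≤ s) (hst : s ≤ t) :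
    ⟪heatL2 x s, heatL2 x t⟫ = (√(2 * Real.pi))⁻¹ * (√(t + s) - √(t - s)) := by
  have hms := memLp_heatIntegrand x s
  have hmt := memLp_heatIntegrand x t
  have hint : Integrable (fun q => heatIntegrand x s q * heatIntegrand x t q) spaceTime :=
    hms.integrable_mul hmt
  have e : ⟪heatL2 x s, heatL2 x t⟫
      = ∫ q, heatIntegrand x s q * heatIntegrand x t q ∂spaceTime := by
    rw [L2.inner_def]
    refine integral_congr_ae ?_
    filter_upwards [hms.coeFn_toLp, hmt.coeFn_toLp] with q h1 h2
    simp only [heatL2]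
    rw [h1, h2]
    simp [mul_comm]
  rw [e]
  unfold spaceTime at hint ⊢
  rw [integral_prod_symm _ hint, ← integral_inv_sqrt_sub hs hst,
    intervalIntegral.integral_of_le hs, ← integral_indicator measurableSet_Ioc,
    ← integral_indicator measurableSet_Ici]
  refine integral_congr_ae ?_
  have h0 : ∀ᵐ r : ℝ, r ≠ 0 := by simp [ae_iff]
  have h1 : ∀ᵐ r : ℝ, r ≠ s := by simp [ae_iff]
  filter_upwards [h0, h1] with r h0 h1
  by_cases hr : r ∈ Ioc 0 s
  · have hrs : r < s := lt_of_le_of_ne hr.2 h1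
    rw [indicator_of_mem (show r ∈ Ici 0 from hr.1.le), indicator_of_mem hr]
    have m1 : r ∈ Icc 0 s := ⟨hr.1.le, hr.2⟩
    have m2 : r ∈ Icc 0 t := ⟨hr.1.le, hr.2.trans hst⟩
    simp only [heatIntegrand, indicator_of_mem m1, indicator_of_mem m2]
    rw [integral_heatKernel_mul (by linarith) (by linarith)]
    congr 3
    ring
  · rw [indicator_of_notMem hr]
    by_cases hr0 : r ∈ Ici 0
    · have m1 : r ∉ Icc 0 s := fun h => hr ⟨lt_of_le_of_ne h.1 (Ne.symm h0), h.2⟩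
      rw [indicator_of_mem hr0]
      simp [heatIntegrand, indicator_of_notMem m1]
    · rw [indicator_of_notMem hr0]

/-! ### Square roots of integers -/

theorem sqrt_add_one_le {a : ℝ} (ha : 0 ≤ a) : √(a + 1) ≤ √a + 1 :=
  Real.sqrt_le_iff.2 ⟨by positivity, by nlinarith [Real.sq_sqrt ha, Real.sqrt_nonneg a]⟩

/-- The increment `√(m + 1) - √m`. -/
def sqrtStep (m : ℕ) : ℝ := √((m : ℝ) + 1) - √(m : ℝ)

theorem sqrtStep_nonneg (m : ℕ) : 0 ≤ sqrtStep m :=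
  sub_nonneg.2 (Real.sqrt_le_sqrt (by linarith))

theorem sqrtStep_le_one (m : ℕ) : sqrtStep m ≤ 1 := by
  have h := sqrt_add_one_le (a := m) (by positivity)
  unfold sqrtStep
  linarith

theorem sqrtStep_antitone : Antitone sqrtStep := by
  refine antitone_nat_of_succ_le fun m => ?_
  unfold sqrtStep
  push_cast
  set a := √(m : ℝ) with ha
  set b := √((m : ℝ) + 1) with hb
  set c := √((m : ℝ) + 1 + 1) with hc
  have hm : (0 : ℝ) ≤ m := by positivity
  have ha2 : a ^ 2 = m := Real.sq_sqrt (by positivity)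
  have hb2 : b ^ 2 = m + 1 := Real.sq_sqrt (by positivity)
  have hc2 : c ^ 2 = m + 1 + 1 := Real.sq_sqrt (by positivity)
  have hb0 : 0 ≤ b := Real.sqrt_nonneg _
  have : a + c ≤ 2 * b := abs_le_of_sq_le_sq' (by nlinarith [sq_nonneg (a - c)]) (by positivity) |>.2
  linarith

/-- The second difference `√|r + 1| - 2 √|r| + √|r - 1|`. -/
def sqrtBend (r : ℝ) : ℝ := √|r + 1| - 2 * √|r| + √|r - 1|

theorem sqrtBend_neg (r : ℝ) : sqrtBend (-r) = sqrtBend r := by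
  unfold sqrtBend
  rw [show -r + 1 = -(r - 1) by ring, show -r - 1 = -(r + 1) by ring]
  simp only [abs_neg]
  ring

theorem sqrtBend_natCast_add_one (m : ℕ) :
    sqrtBend (m + 1) = -(sqrtStep m - sqrtStep (m + 1)) := by
  unfold sqrtBend sqrtStep
  push_cast
  rw [abs_of_nonneg (by positivity), abs_of_nonneg (by positivity), add_sub_cancel_right,
    abs_of_nonneg (by positivity)]
  ring

theorem abs_sqrtBend_natCast_add_one (m : ℕ) :
    |sqrtBend (m + 1)| = sqrtStep m - sqrtStep (m + 1) := by
  rw [sqrtBend_natCast_add_one, abs_neg, abs_of_nonneg]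
  exact sub_nonneg.2 (sqrtStep_antitone (Nat.le_succ m))

theorem sum_abs_sqrtBend_le_one (i M : ℕ) :
    ∑ j ∈ Finset.range M, |sqrtBend ((i + j : ℕ) + 1)| ≤ 1 := by
  have h : ∀ j, |sqrtBend ((i + j : ℕ) + 1)| = sqrtStep (i + j) - sqrtStep (i + (j + 1)) :=
    fun j => by rw [abs_sqrtBend_natCast_add_one, add_assoc]
  simp_rw [h]
  rw [Finset.sum_range_sub' (fun j => sqrtStep (i + j))]
  linarith [sqrtStep_nonneg (i + M), sqrtStep_le_one (i + 0)]

/-- Off the diagonal the sum telescopes on both sides, with total at most `1` each; the diagonal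
term is `√1 + √1 = 2`. -/
theorem sum_abs_sqrtBend_sub_le (i : ℕ) (s : Finset ℕ) :
    ∑ j ∈ s, |sqrtBend ((i : ℝ) - j)| ≤ 4 := by
  obtain ⟨M, hM⟩ := s.exists_nat_subset_range
  have hsub : s ⊆ Finset.range (i + (1 + M)) :=
    hM.trans (Finset.range_subset_range.2 (by omega))
  refine (Finset.sum_le_sum_of_subset_of_nonneg hsub fun _ _ _ => abs_nonneg _).trans ?_
  rw [Finset.sum_range_add, Finset.sum_range_add, Finset.sum_range_one,
    ← Finset.sum_range_reflect]
  have e1 : ∀ j ∈ Finset.range i, |sqrtBend ((i : ℝ) - (i - 1 - j : ℕ))|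
      = |sqrtBend ((0 + j : ℕ) + 1)| := by
    intro j hj
    rw [Finset.mem_range] at hj
    rw [show i - 1 - j = i - (j + 1) by omega, Nat.cast_sub (by omega)]
    congr 2
    push_cast
    ring
  have e2 : ∀ j ∈ Finset.range M, |sqrtBend ((i : ℝ) - (i + (1 + j) : ℕ))|
      = |sqrtBend ((0 + j : ℕ) + 1)| := by
    intro j _
    rw [← sqrtBend_neg]
    congr 2
    push_cast
    ring
  rw [Finset.sum_congr rfl e1, Finset.sum_congr rfl e2]
  have h0 : |sqrtBend ((i : ℝ) - (i + 0 : ℕ))| = 2 := by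
    simp [sqrtBend]
    norm_num
  rw [h0]
  linarith [sum_abs_sqrtBend_le_one 0 i, sum_abs_sqrtBend_le_one 0 M]

theorem sum_abs_sqrtBend_odd_le (i M : ℕ) :
    ∑ j ∈ Finset.range M, |sqrtBend ((2 * (i + j) : ℕ) + 1)| ≤ 1 := by
  have h : ∀ j, |sqrtBend ((2 * (i + j) : ℕ) + 1)|
      ≤ sqrtStep (2 * (i + j)) - sqrtStep (2 * (i + (j + 1))) := fun j => by
    rw [abs_sqrtBend_natCast_add_one]
    exact sub_le_sub_left (sqrtStep_antitone (by omega)) _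
  refine (Finset.sum_le_sum fun j _ => h j).trans ?_
  rw [Finset.sum_range_sub' (fun j => sqrtStep (2 * (i + j)))]
  linarith [sqrtStep_nonneg (2 * (i + M)), sqrtStep_le_one (2 * (i + 0))]

/-! ### Covariances of the increments on the grid -/

/-- `√(i + j) - √|i - j|`, the covariance of `F(t_i)` and `F(t_j)` up to a factor. -/
def sqrtCov (i j : ℕ) : ℝ := √((i : ℝ) + j) - √|(i : ℝ) - j|

theorem abs_sqrt_sub_sqrt_le_one {a b : ℝ} (ha : 0 ≤ a) (hb : 0 ≤ b) (h : |a - b| ≤ 1) :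
    |√a - √b| ≤ 1 := by
  rw [abs_le] at h ⊢
  have h1 := sqrt_add_one_le ha
  have h2 := sqrt_add_one_le hb
  have h3 : √b ≤ √(a + 1) := Real.sqrt_le_sqrt (by linarith)
  have h4 : √a ≤ √(b + 1) := Real.sqrt_le_sqrt (by linarith)
  constructor <;> linarith

theorem abs_sqrtCov_succ_sub_le (i k : ℕ) : |sqrtCov (i + 1) k - sqrtCov i k| ≤ 2 := by
  have h1 := abs_sqrt_sub_sqrt_le_one (a := (i : ℝ) + 1 + k) (b := i + k) (by positivity)
    (by positivity) (by rw [show (i : ℝ) + 1 + k - (i + k) = 1 by ring]; simp)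
  have h2 := abs_sqrt_sub_sqrt_le_one (a := |(i : ℝ) + 1 - k|) (b := |(i : ℝ) - k|)
    (abs_nonneg _) (abs_nonneg _) ((abs_abs_sub_abs_le_abs_sub _ _).trans
      (by rw [show (i : ℝ) + 1 - k - (i - k) = 1 by ring]; simp))
  unfold sqrtCov
  push_cast
  rw [abs_le] at h1 h2 ⊢
  constructor <;> linarith [h1.1, h1.2, h2.1, h2.2]

/-- The covariance of two increments splits into a part depending on `i + j` and a part depending on
`i - j`, both of them second differences of the square root. -/
theorem sqrtCov_second_difference (i j : ℕ) :
    sqrtCov (i + 1) (j + 1) - sqrtCov (i + 1) j - (sqrtCov i (j + 1) - sqrtCov i j)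
      = sqrtBend ((i + j : ℕ) + 1) + sqrtBend ((i : ℝ) - j) := by
  unfold sqrtCov sqrtBend
  push_cast
  have h1 : |(i : ℝ) + j + 1 + 1| = i + 1 + (j + 1) := by
    rw [abs_of_nonneg (by positivity)]; ring
  have h2 : |(i : ℝ) + j + 1| = i + 1 + j := by rw [abs_of_nonneg (by positivity)]; ring
  have h3 : |(i : ℝ) + j + 1 - 1| = i + j := by
    rw [add_sub_cancel_right, abs_of_nonneg (by positivity)]
  rw [h1, h2, h3, show (i : ℝ) + 1 - (j + 1) = i - j by ring,
    show (i : ℝ) - j + 1 = i + 1 - j by ring, show (i : ℝ) - j - 1 = i - (j + 1) by ring,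
    show (i : ℝ) + (j + 1) = i + 1 + j by ring]
  ring

/-- The element of `L²` whose Wiener integral is `F(t_{j+1}) - F(t_j)`. -/
def stepL2 (x : ℝ) (n j : ℕ) : SpaceTimeL2 :=
  heatL2 x (gridTime n (j + 1)) - heatL2 x (gridTime n j)

theorem gridTime_nonneg (n j : ℕ) : 0 ≤ gridTime n j := by unfold gridTime; positivity

theorem inner_heatL2_gridTime (x : ℝ) (n i j : ℕ) :
    ⟪heatL2 x (gridTime n i), heatL2 x (gridTime n j)⟫
      = (√(2 * Real.pi))⁻¹ * √(1 / n) * sqrtCov i j := by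
  have key : ∀ {i j : ℕ}, i ≤ j → ⟪heatL2 x (gridTime n i), heatL2 x (gridTime n j)⟫
      = (√(2 * Real.pi))⁻¹ * √(1 / n) * sqrtCov i j := by
    intro i j h
    have hij : (i : ℝ) ≤ j := by exact_mod_cast h
    rw [inner_heatL2 x (gridTime_nonneg n i) (by unfold gridTime; gcongr), sqrtCov, mul_assoc,
      mul_sub (√(1 / (n : ℝ))), ← Real.sqrt_mul (by positivity), ← Real.sqrt_mul (by positivity),
      abs_sub_comm, abs_of_nonneg (sub_nonneg.2 hij)]
    unfold gridTime
    congr 3 <;> ring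
  rcases le_total i j with h | h
  · exact key h
  · rw [real_inner_comm, key h]
    congr 1
    unfold sqrtCov
    rw [add_comm, abs_sub_comm]

theorem inv_sqrt_two_pi_le_one : (√(2 * Real.pi))⁻¹ ≤ 1 := by
  refine inv_le_one_of_one_le₀ (Real.one_le_sqrt.2 ?_)
  linarith [Real.pi_gt_three]

theorem inv_sqrt_mul_le (n : ℕ) {a b : ℝ} (hb : 0 ≤ b) (h : a ≤ b) :
    (√(2 * Real.pi))⁻¹ * √(1 / n) * a ≤ b * √(1 / n) := by
  calc (√(2 * Real.pi))⁻¹ * √(1 / n) * a ≤ (√(2 * Real.pi))⁻¹ * √(1 / n) * b := by gcongr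
    _ ≤ 1 * √(1 / n) * b := by gcongr; exact inv_sqrt_two_pi_le_one
    _ = _ := by ring

theorem abs_inv_sqrt_mul (n : ℕ) (a : ℝ) :
    |(√(2 * Real.pi))⁻¹ * √(1 / n) * a| = (√(2 * Real.pi))⁻¹ * √(1 / n) * |a| := by
  rw [abs_mul, abs_of_nonneg (by positivity)]

/-- The correlation of an increment with the process at any grid time is of the order of the variance
of the increment, whatever the distance between the two times. -/
theorem abs_inner_stepL2_heatL2_le (x : ℝ) (n i k : ℕ) :
    |⟪stepL2 x n i, heatL2 x (gridTime n k)⟫| ≤ 2 * √(1 / n) := by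
  rw [stepL2, inner_sub_left, inner_heatL2_gridTime, inner_heatL2_gridTime, ← mul_sub,
    abs_inv_sqrt_mul]
  exact inv_sqrt_mul_le n (by norm_num) (abs_sqrtCov_succ_sub_le i k)

theorem inner_stepL2 (x : ℝ) (n i j : ℕ) :
    ⟪stepL2 x n i, stepL2 x n j⟫ = (√(2 * Real.pi))⁻¹ * √(1 / n)
      * (sqrtBend ((i + j : ℕ) + 1) + sqrtBend ((i : ℝ) - j)) := by
  rw [← sqrtCov_second_difference]
  simp only [stepL2, inner_sub_left, inner_sub_right, inner_heatL2_gridTime]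
  ring

/-- The increments are almost uncorrelated: the absolute covariances with a given increment are
summable, with the order of magnitude of a single variance. -/
theorem sum_abs_inner_stepL2_le (x : ℝ) (n i : ℕ) (s : Finset ℕ) :
    ∑ j ∈ s, |⟪stepL2 x n i, stepL2 x n j⟫| ≤ 5 * √(1 / n) := by
  simp_rw [inner_stepL2, abs_inv_sqrt_mul]
  rw [← Finset.mul_sum]
  refine inv_sqrt_mul_le n (by norm_num) ?_
  have h1 : ∑ j ∈ s, |sqrtBend ((i + j : ℕ) + 1)| ≤ 1 := by
    obtain ⟨M, hM⟩ := s.exists_nat_subset_range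
    exact (Finset.sum_le_sum_of_subset_of_nonneg hM fun _ _ _ => abs_nonneg _).trans
      (sum_abs_sqrtBend_le_one i M)
  calc _ ≤ ∑ j ∈ s, (|sqrtBend ((i + j : ℕ) + 1)| + |sqrtBend ((i : ℝ) - j)|) :=
        Finset.sum_le_sum fun j _ => abs_add_le _ _
    _ ≤ 1 + 4 := by
        rw [Finset.sum_add_distrib]
        exact add_le_add h1 (sum_abs_sqrtBend_sub_le i s)
    _ = 5 := by norm_num

theorem abs_inner_stepL2_le (x : ℝ) (n i j : ℕ) :
    |⟪stepL2 x n i, stepL2 x n j⟫| ≤ 5 * √(1 / n) := by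
  simpa using sum_abs_inner_stepL2_le x n i {j}

theorem norm_stepL2_sq_le (x : ℝ) (n i : ℕ) : ‖stepL2 x n i‖ ^ 2 ≤ 5 * √(1 / n) := by
  rw [← real_inner_self_eq_norm_sq]
  exact (le_abs_self _).trans (abs_inner_stepL2_le x n i i)

theorem norm_stepL2_sq_eq (x : ℝ) (n i : ℕ) :
    ‖stepL2 x n i‖ ^ 2 = (√(2 * Real.pi))⁻¹ * √(1 / n) * (sqrtBend ((2 * i : ℕ) + 1) + 2) := by
  have h0 : sqrtBend 0 = 2 := by
    simp [sqrtBend]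
    norm_num
  rw [← real_inner_self_eq_norm_sq, inner_stepL2, sub_self, ← two_mul i, h0]

/-- The variances of the increments have bounded total variation, on the scale of a single one. -/
theorem sum_abs_norm_stepL2_sq_sub_le (x : ℝ) (n : ℕ) (s : Finset ℕ) :
    ∑ j ∈ s, |‖stepL2 x n (j + 1)‖ ^ 2 - ‖stepL2 x n j‖ ^ 2| ≤ 2 * √(1 / n) := by
  simp_rw [norm_stepL2_sq_eq, ← mul_sub, abs_inv_sqrt_mul, add_sub_add_right_eq_sub]
  rw [← Finset.mul_sum]
  refine inv_sqrt_mul_le n (by norm_num) ?_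
  obtain ⟨M, hM⟩ := s.exists_nat_subset_range
  refine (Finset.sum_le_sum_of_subset_of_nonneg hM fun _ _ _ => abs_nonneg _).trans ?_
  have h0 := sum_abs_sqrtBend_odd_le 0 M
  have h1 := sum_abs_sqrtBend_odd_le 1 M
  simp only [zero_add, add_comm 1] at h0 h1
  calc _ ≤ ∑ j ∈ Finset.range M,
          (|sqrtBend ((2 * (j + 1) : ℕ) + 1)| + |sqrtBend ((2 * j : ℕ) + 1)|) :=
        Finset.sum_le_sum fun j _ => abs_sub _ _
    _ ≤ 1 + 1 := by
        rw [Finset.sum_add_distrib]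
        exact add_le_add h1 h0
    _ = 2 := by norm_num

theorem norm_heatL2_sub_sq_le (x : ℝ) {s t : ℝ} (hs : 0 ≤ s) (hst : s ≤ t) :
    ‖heatL2 x t - heatL2 x s‖ ^ 2 ≤ 2 * √(t - s) := by
  have ht := hs.trans hst
  rw [norm_sub_sq_real, ← real_inner_self_eq_norm_sq, ← real_inner_self_eq_norm_sq,
    real_inner_comm (heatL2 x s), inner_heatL2 x hs hst, inner_heatL2 x hs le_rfl, inner_heatL2 x ht le_rfl]
  simp only [sub_self, Real.sqrt_zero, sub_zero]
  have h1 : √(t + t) + √(s + s) ≤ 2 * √(t + s) := by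
    refine (abs_le_of_sq_le_sq' ?_ (by positivity)).2
    have e1 := Real.sq_sqrt (show 0 ≤ t + t by linarith)
    have e2 := Real.sq_sqrt (show 0 ≤ s + s by linarith)
    have e3 := Real.sq_sqrt (show 0 ≤ t + s by linarith)
    nlinarith [sq_nonneg (√(t + t) - √(s + s))]
  calc _ = (√(2 * Real.pi))⁻¹ * (√(t + t) + √(s + s) - 2 * √(t + s) + 2 * √(t - s)) := by ring
    _ ≤ (√(2 * Real.pi))⁻¹ * (2 * √(t - s)) := by
        gcongr
        linarith
    _ ≤ 1 * (2 * √(t - s)) := by gcongr; exact inv_sqrt_two_pi_le_one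
    _ = _ := by ring

/-! ### Regularity of the test function -/

section

variable {g : ℝ → ℝ → ℝ} {k r : ℕ}

/-- Only times `t ≥ 0` are concerned, because nothing is known about `g` at negative times. -/
theorem exists_eq_zero_of_hasCompactSupport
    (hsupp : HasCompactSupport (fun q : ℝ × ℝ≥0 => g q.1 q.2)) :
    ∃ R : ℝ, 0 ≤ R ∧ ∀ y t, 0 ≤ t → (R < |y| ∨ R < t) → g y t = 0 := by
  obtain ⟨R, hR⟩ := hsupp.isCompact.isBounded.subset_closedBall ((0 : ℝ), (0 : ℝ≥0))
  refine ⟨max R 0, le_max_right _ _, fun y t ht h => ?_⟩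
  have hout : ((y, ⟨t, ht⟩) : ℝ × ℝ≥0) ∉ tsupport (fun q : ℝ × ℝ≥0 => g q.1 q.2) := fun hq => by
    have h1 := hR hq
    rw [Metric.mem_closedBall, Prod.dist_eq, max_le_iff, NNReal.dist_eq, Real.dist_eq] at h1
    simp only [sub_zero, NNReal.coe_zero] at h1
    have h2 : |t| ≤ R := h1.2
    rw [abs_of_nonneg ht] at h2
    rcases h with h | h
    · linarith [le_max_left R 0, h1.1]
    · linarith [le_max_left R 0]
  exact image_eq_zero_of_notMem_tsupport (f := fun q : ℝ × ℝ≥0 => g q.1 q.2) hout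

theorem partialX_zero (y t : ℝ) : partialX g 0 y t = g y t := by simp [partialX]

theorem partialX_eq_zero {R : ℝ} (h0 : ∀ y t, 0 ≤ t → (R < |y| ∨ R < t) → g y t = 0)
    (j : ℕ) {y t : ℝ} (ht : 0 ≤ t) (h : R < |y| ∨ R < t) : partialX g j y t = 0 := by
  have hev : (fun z => g z t) =ᶠ[𝓝 y] fun _ => 0 := by
    rcases h with h | h
    · filter_upwards [(isOpen_lt continuous_const continuous_abs).mem_nhds h] with z hz
      exact h0 z t ht (Or.inl hz)
    · exact Eventually.of_forall fun z => h0 z t ht (Or.inr h)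
  unfold partialX
  rw [hev.iteratedDeriv_eq]
  simp

theorem IsCkr.exists_abs_partialX_le (hg : IsCkr k r g)
    (hsupp : HasCompactSupport (fun q : ℝ × ℝ≥0 => g q.1 q.2)) {j : ℕ} (hj : j ≤ k) :
    ∃ K, ∀ y t, 0 ≤ t → |partialX g j y t| ≤ K := by
  obtain ⟨R, hR, h0⟩ := exists_eq_zero_of_hasCompactSupport hsupp
  obtain ⟨K, hK⟩ := (isCompact_Icc.prod isCompact_Icc :
    IsCompact (Icc (-R) R ×ˢ Icc (0 : ℝ) R)).exists_bound_of_continuousOn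
      ((hg.continuousOn_partialX j hj).mono (prod_mono (subset_univ _) fun t ht => ht.1))
  refine ⟨max K 0, fun y t ht => ?_⟩
  by_cases h : R < |y| ∨ R < t
  · rw [partialX_eq_zero h0 j ht h]
    simp
  · push Not at h
    exact (hK (y, t) ⟨abs_le.1 h.1, ht, h.2⟩).trans (le_max_left _ _)

theorem IsCkr.exists_isBoundedTower (hg : IsCkr k r g)
    (hsupp : HasCompactSupport (fun q : ℝ × ℝ≥0 => g q.1 q.2)) :
    ∃ K, ∀ t, 0 ≤ t → IsBoundedTower k K (fun j y => partialX g j y t) := by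
  choose! K hK using fun (j : ℕ) (hj : j ≤ k) => hg.exists_abs_partialX_le hsupp hj
  refine ⟨∑ j ∈ Finset.range (k + 1), |K j|, fun t ht => ⟨fun j hj => ?_, fun j hj y => ?_,
    fun j hj y => ?_⟩⟩
  · exact (hg.contDiff_space t ht).continuous_iteratedDeriv j (by exact_mod_cast hj)
  · have h := ((hg.contDiff_space t ht).differentiable_iteratedDeriv j
      (by exact_mod_cast hj)).differentiableAt (x := y) |>.hasDerivAt
    unfold partialX
    rwa [iteratedDeriv_succ]
  · exact (hK j hj y t ht).trans ((le_abs_self _).trans (Finset.single_le_sum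
      (f := fun j => |K j|) (fun _ _ => abs_nonneg _) (Finset.mem_range.2 (by omega))))

/-- Boundedness of `∂ₜ g`: near `t = 0` it is part of the definition of the class, away from `t = 0`
it follows from continuity and compactness. -/
theorem IsCkr.exists_abs_partialTX_zero_le (hg : IsCkr k r g)
    (hsupp : HasCompactSupport (fun q : ℝ × ℝ≥0 => g q.1 q.2)) :
    ∃ L, ∀ y t, 0 < t → |partialTX g 0 y t| ≤ L := by
  obtain ⟨R, hR, h0⟩ := exists_eq_zero_of_hasCompactSupport hsupp
  obtain ⟨M, hM⟩ := hg.bounded_partialTX (Icc (-R) R) isCompact_Icc 0 (Nat.zero_le _)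
  obtain ⟨δ, hδ, hM⟩ := mem_nhdsGT_iff_exists_Ioo_subset.1 hM
  obtain ⟨K, hK⟩ := (isCompact_Icc.prod isCompact_Icc :
    IsCompact (Icc (-R) R ×ˢ Icc δ R)).exists_bound_of_continuousOn
      ((hg.continuousOn_partialTX 0 (Nat.zero_le _)).mono
        (prod_mono (subset_univ _) fun t ht => lt_of_lt_of_le hδ ht.1))
  refine ⟨max (max K M) 0, fun y t ht => ?_⟩
  by_cases h : R < |y| ∨ R < t
  · have hev : (fun s => partialX g 0 y s) =ᶠ[𝓝 t] fun _ => 0 := by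
      rcases h with h | h
      · filter_upwards [lt_mem_nhds ht] with s hs
        exact partialX_eq_zero h0 0 hs.le (Or.inl h)
      · filter_upwards [lt_mem_nhds ht, lt_mem_nhds h] with s hs hs'
        exact partialX_eq_zero h0 0 hs.le (Or.inr hs')
    unfold partialTX
    rw [hev.deriv_eq]
    simp
  · push Not at h
    rcases lt_or_ge t δ with htδ | htδ
    · exact (hM ⟨ht, htδ⟩ y (abs_le.1 h.1)).trans ((le_max_right _ _).trans (le_max_left _ _))
    · exact (hK (y, t) ⟨abs_le.1 h.1, htδ, h.2⟩).trans
        ((le_max_left _ _).trans (le_max_left _ _))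

theorem IsCkr.exists_lipschitz_time (hg : IsCkr k r g)
    (hsupp : HasCompactSupport (fun q : ℝ × ℝ≥0 => g q.1 q.2)) :
    ∃ L, ∀ y s t, 0 ≤ s → s ≤ t → |g y t - g y s| ≤ L * (t - s) := by
  obtain ⟨L, h⟩ := hg.exists_abs_partialTX_zero_le hsupp
  refine ⟨L, fun y s t hs hst => ?_⟩
  rcases hst.eq_or_lt with rfl | hst
  · simp
  have hc : ContinuousOn (fun s => partialX g 0 y s) (Icc s t) :=
    (hg.continuousOn_partialX 0 (Nat.zero_le _)).comp (f := fun s : ℝ => (y, s))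
      (by fun_prop) fun u hu => ⟨mem_univ _, hs.trans hu.1⟩
  obtain ⟨ξ, hξ, e⟩ := exists_deriv_eq_slope (fun s => partialX g 0 y s) hst hc fun u hu =>
    (hg.differentiableAt_time 0 (Nat.zero_le _) y u
      (lt_of_le_of_lt hs hu.1)).differentiableWithinAt
  have h1 := h y ξ (lt_of_le_of_lt hs hξ.1)
  unfold partialTX at h1
  rw [e, abs_div, abs_of_pos (sub_pos.2 hst), div_le_iff₀ (sub_pos.2 hst)] at h1
  simpa [partialX_zero] using h1

end

theorem abs_sub_le_of_hasDerivAt {f f' : ℝ → ℝ} {K : ℝ} (hf : ∀ y, HasDerivAt f (f' y) y)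
    (hK : ∀ y, |f' y| ≤ K) (a b : ℝ) : |f b - f a| ≤ K * |b - a| :=
  Convex.norm_image_sub_le_of_norm_hasDerivWithin_le (s := univ)
    (fun y _ => (hf y).hasDerivWithinAt) (fun y _ => hK y) convex_univ (mem_univ a) (mem_univ b)

theorem IsBoundedTower.abs_sub_le {N : ℕ} {K : ℝ} {u : ℕ → ℝ → ℝ} (hu : IsBoundedTower N K u)
    {j : ℕ} (hj : j < N) (a b : ℝ) : |u j b - u j a| ≤ K * |b - a| :=
  abs_sub_le_of_hasDerivAt (hu.hasDerivAt j hj) (hu.abs_le (j + 1) hj) a b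

theorem IsBoundedTower.abs_taylor_le {N : ℕ} {K : ℝ} {u : ℕ → ℝ → ℝ} (hu : IsBoundedTower N K u)
    (hN : 2 ≤ N) (a b : ℝ) : |u 0 b - u 0 a - u 1 a * (b - a)| ≤ K * (b - a) ^ 2 := by
  have hK : 0 ≤ K := (abs_nonneg _).trans (hu.abs_le 0 (Nat.zero_le _) 0)
  have h := Convex.norm_image_sub_le_of_norm_hasDerivWithin_le (s := uIcc a b)
    (f := fun y => u 0 y - u 1 a * (y - a)) (f' := fun y => u 1 y - u 1 a) (C := K * |b - a|)
    (x := a) (y := b)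
    (fun y _ => by
      simpa using ((hu.hasDerivAt 0 (by omega) y).fun_sub
        (((hasDerivAt_id' y).sub_const a).const_mul (u 1 a))).hasDerivWithinAt)
    (fun y hy => (hu.abs_sub_le (j := 1) (by omega) a y).trans (by
      exact mul_le_mul_of_nonneg_left (abs_sub_left_of_mem_uIcc hy) hK)) (convex_uIcc a b) left_mem_uIcc right_mem_uIcc
  simp only [Real.norm_eq_abs, sub_self, mul_zero, sub_zero] at h
  rw [mul_assoc, ← sq, sq_abs] at h
  convert h using 2
  ring

theorem IsBoundedTower.mono {M N : ℕ} {K : ℝ} {u : ℕ → ℝ → ℝ} (hu : IsBoundedTower N K u)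
    (h : M ≤ N) : IsBoundedTower M K u :=
  ⟨fun k hk => hu.continuous k (hk.trans h), fun k hk => hu.hasDerivAt k (hk.trans_le h),
    fun k hk => hu.abs_le k (hk.trans h)⟩

theorem IsBoundedTower.shift {N : ℕ} {K : ℝ} {u : ℕ → ℝ → ℝ} (hu : IsBoundedTower (N + 1) K u) :
    IsBoundedTower N K (fun k => u (k + 1)) :=
  ⟨fun k hk => hu.continuous (k + 1) (by omega), fun k hk => hu.hasDerivAt (k + 1) (by omega),
    fun k hk => hu.abs_le (k + 1) (by omega)⟩

/-! ### Random variables with all moments -/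

/-- All absolute moments of finite order are finite; unlike the members of a single `Lᵖ`, such random
variables are closed under products. -/
def HasAllMoments {Ω : Type*} [MeasurableSpace Ω] (Z : Ω → ℝ) (P : Measure Ω) : Prop :=
  ∀ p : ℝ≥0∞, p ≠ ∞ → MemLp Z p P

namespace HasAllMoments

variable {Ω : Type*} [MeasurableSpace Ω] {P : Measure Ω} {Y Z : Ω → ℝ}

theorem integrable (hZ : HasAllMoments Z P) : Integrable Z P :=
  memLp_one_iff_integrable.1 (hZ 1 (by simp))

theorem add (hY : HasAllMoments Y P) (hZ : HasAllMoments Z P) :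
    HasAllMoments (fun ω => Y ω + Z ω) P := fun p hp => (hY p hp).add (hZ p hp)

theorem sub (hY : HasAllMoments Y P) (hZ : HasAllMoments Z P) :
    HasAllMoments (fun ω => Y ω - Z ω) P := fun p hp => (hY p hp).sub (hZ p hp)

theorem const_mul (hZ : HasAllMoments Z P) (c : ℝ) : HasAllMoments (fun ω => c * Z ω) P :=
  fun p hp => (hZ p hp).const_mul c

theorem abs (hZ : HasAllMoments Z P) : HasAllMoments (fun ω => |Z ω|) P :=
  fun p hp => (hZ p hp).abs

theorem mul (hY : HasAllMoments Y P) (hZ : HasAllMoments Z P) :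
    HasAllMoments (fun ω => Y ω * Z ω) P := fun p hp => by
  have : ENNReal.HolderTriple (2 * p) (2 * p) p := ⟨by
    rw [ENNReal.mul_inv (by simp) (by simp), ← add_mul, ENNReal.inv_two_add_inv_two, one_mul]⟩
  have h2 : 2 * p ≠ ∞ := ENNReal.mul_ne_top (by simp) hp
  exact (hZ _ h2).mul (hY _ h2)

theorem sq (hZ : HasAllMoments Z P) : HasAllMoments (fun ω => Z ω ^ 2) P := by
  simpa only [pow_two] using hZ.mul hZ

theorem sum {ι : Type*} {s : Finset ι} {Z : ι → Ω → ℝ} (h : ∀ i ∈ s, HasAllMoments (Z i) P) :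
    HasAllMoments (fun ω => ∑ i ∈ s, Z i ω) P := fun p hp =>
  memLp_finsetSum s fun i hi => h i hi p hp

theorem of_bounded [IsFiniteMeasure P] (hZ : AEStronglyMeasurable Z P) (K : ℝ)
    (h : ∀ ω, |Z ω| ≤ K) : HasAllMoments Z P :=
  fun _ _ => MemLp.of_bound hZ K (Eventually.of_forall h)

end HasAllMoments

theorem WhiteNoise.hasAllMoments {Ω : Type*} [MeasurableSpace Ω] {P : Measure Ω}
    (W : WhiteNoise P) (h : SpaceTimeL2) : HasAllMoments (W.integral h) P :=
  W.memLp_integral h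

theorem WhiteNoise.hasAllMoments_comp {Ω : Type*} [MeasurableSpace Ω] {P : Measure Ω}
    [IsProbabilityMeasure P] (W : WhiteNoise P) {N : ℕ} {K : ℝ} {u : ℕ → ℝ → ℝ}
    (hu : IsBoundedTower N K u) {k : ℕ} (hk : k ≤ N) (h : SpaceTimeL2) :
    HasAllMoments (fun ω => u k (W.integral h ω)) P :=
  .of_bounded ((hu.continuous k hk).comp_aestronglyMeasurable
    (W.hasAllMoments h 0 (by simp)).aestronglyMeasurable) K fun _ => hu.abs_le k hk _

/-- The second moment of a sum, bounded by the sum of the bounds `B` on the mixed second moments. -/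
theorem integral_sum_sq_le {Ω ι : Type*} [MeasurableSpace Ω] {P : Measure Ω} (s : Finset ι)
    {Z : ι → Ω → ℝ} {B : ι → ι → ℝ} (h : ∀ i ∈ s, HasAllMoments (Z i) P)
    (hB : ∀ i ∈ s, ∀ j ∈ s, |∫ ω, Z i ω * Z j ω ∂P| ≤ B i j) :
    ∫ ω, (∑ i ∈ s, Z i ω) ^ 2 ∂P ≤ ∑ i ∈ s, ∑ j ∈ s, B i j := by
  simp_rw [pow_two, Finset.sum_mul_sum]
  rw [integral_finsetSum _ fun i hi =>
    (HasAllMoments.sum fun j hj => (h i hi).mul (h j hj)).integrable]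
  refine Finset.sum_le_sum fun i hi => ?_
  rw [integral_finsetSum _ fun j hj => ((h i hi).mul (h j hj)).integrable]
  exact Finset.sum_le_sum fun j hj => (le_abs_self _).trans (hB i hi j hj)

theorem abs_integral_mul_le_of_sq_le {Ω : Type*} [MeasurableSpace Ω] {P : Measure Ω}
    {Y Z : Ω → ℝ} (hY : HasAllMoments Y P) (hZ : HasAllMoments Z P) {V : ℝ}
    (h1 : ∫ ω, Y ω ^ 2 ∂P ≤ V) (h2 : ∫ ω, Z ω ^ 2 ∂P ≤ V) : |∫ ω, Y ω * Z ω ∂P| ≤ V := by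
  have h3 : |∫ ω, Y ω * Z ω ∂P| ≤ ∫ ω, (2⁻¹ * Y ω ^ 2 + 2⁻¹ * Z ω ^ 2) ∂P := by
    refine (abs_integral_le_integral_abs).trans (integral_mono (hY.mul hZ).abs.integrable
      ((hY.sq.const_mul _).add (hZ.sq.const_mul _)).integrable fun ω => ?_)
    simp only
    rw [abs_le]
    constructor <;> nlinarith [sq_nonneg (Y ω - Z ω), sq_nonneg (Y ω + Z ω)]
  rw [integral_add (hY.sq.const_mul _).integrable (hZ.sq.const_mul _).integrable,
    integral_const_mul, integral_const_mul] at h3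
  linarith

theorem WhiteNoise.integral_pow_four {Ω : Type*} [MeasurableSpace Ω] {P : Measure Ω}
    [IsProbabilityMeasure P] (W : WhiteNoise P) (h : SpaceTimeL2) :
    ∫ ω, W.integral h ω ^ 4 ∂P = 3 * (‖h‖ ^ 2) ^ 2 := by
  have e := W.integral_mul_comp_eq h (fun _ : Unit => h) (f := fun w => w () ^ 3)
    (f' := fun w => ‖h‖ ^ 2 * 3 * w () ^ 2) (by fun_prop) (by fun_prop)
    ((polyGrowth_eval ()).pow 3)
    ((PolyGrowth.of_bounded |‖h‖ ^ 2 * 3| fun _ => le_rfl).mul ((polyGrowth_eval ()).pow 2))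
    (fun w => by
      have h1 : HasDerivAt (fun s : ℝ => (w + s • fun _ : Unit => ⟪h, h⟫) ()) ⟪h, h⟫ 0 := by
        simpa using ((hasDerivAt_id (0 : ℝ)).mul_const ⟪h, h⟫).const_add (w ())
      refine (h1.fun_pow 3).congr_deriv ?_
      simp
      ring)
  rw [integral_const_mul, W.integral_sq] at e
  rw [show 3 * (‖h‖ ^ 2) ^ 2 = ‖h‖ ^ 2 * 3 * ‖h‖ ^ 2 by ring, ← e]
  refine integral_congr_ae (Eventually.of_forall fun ω => ?_)
  simp only
  ring

/-! ### The two fluctuating sums -/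

section

variable {Ω : Type*} [MeasurableSpace Ω] {P : Measure Ω} [IsProbabilityMeasure P]

namespace WhiteNoise

variable (W : WhiteNoise P)

/-- The second order Hermite polynomial of `∫ h dW`, that is `(∫ h dW)² - E[(∫ h dW)²]`. -/
def hermiteTwo (h : SpaceTimeL2) (ω : Ω) : ℝ := W.integral h ω ^ 2 - ‖h‖ ^ 2

theorem hasAllMoments_hermiteTwo (h : SpaceTimeL2) : HasAllMoments (W.hermiteTwo h) P :=
  (W.hasAllMoments h).sq.sub (.of_bounded aestronglyMeasurable_const |‖h‖ ^ 2| fun _ => le_rfl)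

/-- The version of `abs_integral_hermite_mul_hermite_sub_le` for differences `u(Y) - u'(Y')` and
`v(Z) - v'(Z')`: expanding the product, the main terms recombine into the mean of the product of the
differences, which is at most `V`. -/
theorem abs_integral_diff_hermiteTwo_mul_le {K ε V : ℝ} {u u' v v' : ℕ → ℝ → ℝ}
    {a b y y' z z' : SpaceTimeL2}
    (hu : IsBoundedTower 4 K u) (hu' : IsBoundedTower 4 K u') (hv : IsBoundedTower 4 K v)
    (hv' : IsBoundedTower 4 K v') (hε : ∀ h ∈ ({y, y', z, z'} : Set SpaceTimeL2),
      |⟪a, h⟫| ≤ ε ∧ |⟪b, h⟫| ≤ ε)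
    (h1 : ∫ ω, (u 0 (W.integral y ω) - u' 0 (W.integral y' ω)) ^ 2 ∂P ≤ V)
    (h2 : ∫ ω, (v 0 (W.integral z ω) - v' 0 (W.integral z' ω)) ^ 2 ∂P ≤ V) :
    |∫ ω, ((u 0 (W.integral y ω) - u' 0 (W.integral y' ω)) * W.hermiteTwo a ω)
        * ((v 0 (W.integral z ω) - v' 0 (W.integral z' ω)) * W.hermiteTwo b ω) ∂P|
      ≤ 2 * ⟪a, b⟫ ^ 2 * V + 64 * K ^ 2 * (|⟪a, b⟫| * ε ^ 2 + ε ^ 4) := by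
  have ey := hε y (by simp)
  have ey' := hε y' (by simp)
  have ez := hε z (by simp)
  have ez' := hε z' (by simp)
  have d1 := W.abs_integral_hermite_mul_hermite_sub_le hu hv ey.1 ez.1 ey.2 ez.2
  have d2 := W.abs_integral_hermite_mul_hermite_sub_le hu hv' ey.1 ez'.1 ey.2 ez'.2
  have d3 := W.abs_integral_hermite_mul_hermite_sub_le hu' hv ey'.1 ez.1 ey'.2 ez.2
  have d4 := W.abs_integral_hermite_mul_hermite_sub_le hu' hv' ey'.1 ez'.1 ey'.2 ez'.2
  have my := W.hasAllMoments_comp hu (Nat.zero_le _) y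
  have my' := W.hasAllMoments_comp hu' (Nat.zero_le _) y'
  have mz := W.hasAllMoments_comp hv (Nat.zero_le _) z
  have mz' := W.hasAllMoments_comp hv' (Nat.zero_le _) z'
  have ma := W.hasAllMoments_hermiteTwo a
  have mb := W.hasAllMoments_hermiteTwo b
  have hV := abs_integral_mul_le_of_sq_le (my.sub my') (mz.sub mz') h1 h2
  have split : ∀ R : Ω → ℝ, HasAllMoments R P →
      ∫ ω, (u 0 (W.integral y ω) - u' 0 (W.integral y' ω))
        * (v 0 (W.integral z ω) - v' 0 (W.integral z' ω)) * R ω ∂P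
      = ∫ ω, u 0 (W.integral y ω) * v 0 (W.integral z ω) * R ω ∂P
        - ∫ ω, u 0 (W.integral y ω) * v' 0 (W.integral z' ω) * R ω ∂P
        - ∫ ω, u' 0 (W.integral y' ω) * v 0 (W.integral z ω) * R ω ∂P
        + ∫ ω, u' 0 (W.integral y' ω) * v' 0 (W.integral z' ω) * R ω ∂P := by
    intro R hR
    have i1 := ((my.mul mz).mul hR)
    have i2 := ((my.mul mz').mul hR)
    have i3 := ((my'.mul mz).mul hR)
    have i4 := ((my'.mul mz').mul hR)
    rw [← integral_sub i1.integrable i2.integrable,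
      ← integral_sub (i1.sub i2).integrable i3.integrable,
      ← integral_add ((i1.sub i2).sub i3).integrable i4.integrable]
    refine integral_congr_ae (Eventually.of_forall fun ω => ?_)
    simp only
    ring
  have e1 := split _ (ma.mul mb)
  have e2 := split (fun _ => 1) (.of_bounded aestronglyMeasurable_const 1 (by simp))
  simp only [mul_one] at e2
  have e3 : ∫ ω, ((u 0 (W.integral y ω) - u' 0 (W.integral y' ω)) * W.hermiteTwo a ω)
        * ((v 0 (W.integral z ω) - v' 0 (W.integral z' ω)) * W.hermiteTwo b ω) ∂P
      = ∫ ω, (u 0 (W.integral y ω) - u' 0 (W.integral y' ω))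
        * (v 0 (W.integral z ω) - v' 0 (W.integral z' ω))
        * (W.hermiteTwo a ω * W.hermiteTwo b ω) ∂P := by
    refine integral_congr_ae (Eventually.of_forall fun ω => ?_)
    simp only
    ring
  have hρ : |2 * ⟪a, b⟫ ^ 2 * ∫ ω, (u 0 (W.integral y ω) - u' 0 (W.integral y' ω))
        * (v 0 (W.integral z ω) - v' 0 (W.integral z' ω)) ∂P| ≤ 2 * ⟪a, b⟫ ^ 2 * V := by
    rw [abs_mul, abs_of_nonneg (by positivity)]
    gcongr
  rw [e2] at hρ
  rw [e3, e1]
  simp only [hermiteTwo, ← mul_assoc]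
  rw [abs_le] at d1 d2 d3 d4 hρ ⊢
  constructor <;> linarith [d1.1, d2.1, d3.1, d4.1, d1.2, d2.2, d3.2, d4.2, hρ.1, hρ.2]

variable (x : ℝ) {n : ℕ} {K V : ℝ} {u : ℕ → ℕ → ℝ → ℝ}

/-- Second moment of the sum of the Hermite polynomials of the increments, weighted by the
fluctuations of a smooth function of the process. -/
theorem integral_sum_hermiteTwo_sq_le (hu : ∀ j, IsBoundedTower 4 K (u j)) (c : ℕ) (s : Finset ℕ)
    (hV : ∀ j ∈ s, ∫ ω, (u j 0 (W.integral (heatL2 x (gridTime n j)) ω)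
      - u c 0 (W.integral (heatL2 x (gridTime n c)) ω)) ^ 2 ∂P ≤ V) :
    ∫ ω, (∑ j ∈ s, (-1) ^ j * ((u j 0 (W.integral (heatL2 x (gridTime n j)) ω)
      - u c 0 (W.integral (heatL2 x (gridTime n c)) ω)) * W.hermiteTwo (stepL2 x n j) ω)) ^ 2 ∂P
      ≤ s.card * (50 * √(1 / n) ^ 2 * V
        + 64 * K ^ 2 * (20 * √(1 / n) ^ 3 + 16 * √(1 / n) ^ 4 * s.card)) := by
  set δ := √(1 / (n : ℝ)) with hδ
  have hδ0 : 0 ≤ δ := Real.sqrt_nonneg _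
  have m : ∀ j, HasAllMoments (fun ω => (u j 0 (W.integral (heatL2 x (gridTime n j)) ω)
      - u c 0 (W.integral (heatL2 x (gridTime n c)) ω)) * W.hermiteTwo (stepL2 x n j) ω) P :=
    fun j => ((W.hasAllMoments_comp (hu j) (Nat.zero_le _) _).sub
      (W.hasAllMoments_comp (hu c) (Nat.zero_le _) _)).mul (W.hasAllMoments_hermiteTwo _)
  refine (integral_sum_sq_le s (B := fun i j => 2 * ⟪stepL2 x n i, stepL2 x n j⟫ ^ 2 * V
    + 64 * K ^ 2 * (|⟪stepL2 x n i, stepL2 x n j⟫| * (2 * δ) ^ 2 + (2 * δ) ^ 4))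
    (fun j _ => (m j).const_mul _) fun i hi j hj => ?_).trans ?_
  · have h := W.abs_integral_diff_hermiteTwo_mul_le (a := stepL2 x n i) (b := stepL2 x n j)
      (ε := 2 * δ) (hu i) (hu c) (hu j) (hu c) (by
        have b := fun i k => abs_inner_stepL2_heatL2_le x n i k
        rintro h (rfl | rfl | rfl | rfl) <;> exact ⟨b _ _, b _ _⟩) (hV i hi) (hV j hj)
    have sign : ∀ Z₁ Z₂ : Ω → ℝ, |∫ ω, (-1) ^ i * Z₁ ω * ((-1) ^ j * Z₂ ω) ∂P|
        = |∫ ω, Z₁ ω * Z₂ ω ∂P| := fun Z₁ Z₂ => by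
      have e : ∀ ω, (-1) ^ i * Z₁ ω * ((-1) ^ j * Z₂ ω) = (-1) ^ (i + j) * (Z₁ ω * Z₂ ω) :=
        fun ω => by ring
      simp_rw [e]
      rw [integral_const_mul, abs_mul, abs_neg_one_pow, one_mul]
    exact (sign _ _).trans_le h
  · rw [← nsmul_eq_mul]
    refine Finset.sum_le_card_nsmul s _ _ fun i hi => ?_
    have hV0 : 0 ≤ V := (integral_nonneg fun ω => sq_nonneg _).trans (hV i hi)
    have hs := sum_abs_inner_stepL2_le x n i s
    have hs2 : ∑ j ∈ s, ⟪stepL2 x n i, stepL2 x n j⟫ ^ 2 ≤ 25 * δ ^ 2 := by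
      calc _ ≤ ∑ j ∈ s, 5 * δ * |⟪stepL2 x n i, stepL2 x n j⟫| := by
            refine Finset.sum_le_sum fun j _ => ?_
            rw [← sq_abs, pow_two]
            gcongr
            exact abs_inner_stepL2_le x n i j
        _ ≤ 5 * δ * (5 * δ) := by
            rw [← Finset.mul_sum]
            gcongr
        _ = _ := by ring
    rw [Finset.sum_add_distrib, ← Finset.sum_mul, ← Finset.mul_sum, ← Finset.mul_sum,
      Finset.sum_add_distrib, ← Finset.sum_mul, Finset.sum_const, nsmul_eq_mul]
    calc _ ≤ 2 * (25 * δ ^ 2) * V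
          + 64 * K ^ 2 * (5 * δ * (2 * δ) ^ 2 + s.card * (2 * δ) ^ 4) := by gcongr
      _ = _ := by ring

/-- Second moment of a sum of first order terms `u'(F(t_j)) ΔF_j` whose weights are of the order of the
variance of an increment. -/
theorem integral_sum_linear_sq_le (hu : ∀ j, IsBoundedTower 3 K (fun k => u j (k + 1)))
    (s : Finset ℕ) {w : ℕ → ℝ} (hw : ∀ j, |w j| ≤ 5 * √(1 / n)) :
    ∫ ω, (∑ j ∈ s, w j * (u j 1 (W.integral (heatL2 x (gridTime n j)) ω)
      * W.integral (stepL2 x n j) ω)) ^ 2 ∂P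
      ≤ s.card * (25 * K ^ 2 * (5 * √(1 / n) ^ 3 + 16 * √(1 / n) ^ 4 * s.card)) := by
  set δ := √(1 / (n : ℝ)) with hδ
  have hδ0 : 0 ≤ δ := Real.sqrt_nonneg _
  refine (integral_sum_sq_le s (B := fun i j => 25 * δ ^ 2
    * (K * K * (|⟪stepL2 x n i, stepL2 x n j⟫| + 4 * (2 * δ) ^ 2)))
    (fun j _ => ((W.hasAllMoments_comp (hu j) (Nat.zero_le _) _).mul
      (W.hasAllMoments _)).const_mul _) fun i _ j _ => ?_).trans ?_
  · have h := W.abs_integral_mul_mul_le (a := stepL2 x n i) (b := stepL2 x n j)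
      ((hu i).mono (by norm_num)) ((hu j).mono (by norm_num))
      (abs_inner_stepL2_heatL2_le x n i i) (abs_inner_stepL2_heatL2_le x n i j)
      (abs_inner_stepL2_heatL2_le x n j i) (abs_inner_stepL2_heatL2_le x n j j)
    have hww : |w i * w j| ≤ 25 * δ ^ 2 := by
      rw [abs_mul]
      calc |w i| * |w j| ≤ (5 * δ) * (5 * δ) := by
            gcongr
            exacts [hw i, hw j]
        _ = _ := by ring
    refine le_of_eq_of_le ?_ (mul_le_mul hww h (abs_nonneg _) (by positivity))
    rw [← abs_mul, ← integral_const_mul]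
    congr 1
    refine integral_congr_ae (Eventually.of_forall fun ω => ?_)
    simp only [zero_add]
    ring
  · rw [← nsmul_eq_mul]
    refine Finset.sum_le_card_nsmul s _ _ fun i hi => ?_
    have hs := sum_abs_inner_stepL2_le x n i s
    rw [← Finset.mul_sum, ← Finset.mul_sum, Finset.sum_add_distrib, Finset.sum_const,
      nsmul_eq_mul]
    calc _ ≤ 25 * δ ^ 2 * (K * K * (5 * δ + s.card * (4 * (2 * δ) ^ 2))) := by
          gcongr
          exact mul_self_nonneg K
      _ = _ := by ring

theorem integral_sum_sq_sq_le (s : Finset ℕ) :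
    ∫ ω, (∑ j ∈ s, W.integral (stepL2 x n j) ω ^ 2) ^ 2 ∂P
      ≤ 75 * √(1 / n) ^ 2 * s.card ^ 2 := by
  set δ := √(1 / (n : ℝ)) with hδ
  have m := fun j => W.hasAllMoments (stepL2 x n j)
  have h4 : ∀ j, ∫ ω, (W.integral (stepL2 x n j) ω ^ 2) ^ 2 ∂P ≤ 75 * δ ^ 2 := fun j => by
    simp_rw [← pow_mul]
    rw [W.integral_pow_four]
    calc 3 * (‖stepL2 x n j‖ ^ 2) ^ 2 ≤ 3 * (5 * δ) ^ 2 := by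
          gcongr
          exact norm_stepL2_sq_le x n j
      _ = _ := by ring
  refine (integral_sum_sq_le s (fun j _ => (m j).sq) fun i _ j _ =>
    abs_integral_mul_le_of_sq_le (m i).sq (m j).sq (h4 i) (h4 j)).trans_eq ?_
  simp
  ring

/-- The mean square fluctuation of a smooth function of the process over a time interval. -/
theorem integral_fluctuation_sq_le {L : ℝ} {c j : ℕ} (hcj : c ≤ j)
    (hu : ∀ j, IsBoundedTower 4 K (u j))
    (hlip : ∀ i j, i ≤ j → ∀ y, |u j 0 y - u i 0 y| ≤ L * (gridTime n j - gridTime n i)) :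
    ∫ ω, (u j 0 (W.integral (heatL2 x (gridTime n j)) ω)
      - u c 0 (W.integral (heatL2 x (gridTime n c)) ω)) ^ 2 ∂P
      ≤ 4 * K ^ 2 * √(gridTime n j - gridTime n c)
        + 2 * L ^ 2 * (gridTime n j - gridTime n c) ^ 2 := by
  set fj := heatL2 x (gridTime n j)
  set fc := heatL2 x (gridTime n c)
  set t := gridTime n j - gridTime n c with ht
  have hcj' : gridTime n c ≤ gridTime n j := by unfold gridTime; gcongr
  have ht0 : 0 ≤ t := sub_nonneg.2 hcj'
  have hn := norm_heatL2_sub_sq_le x (gridTime_nonneg n c) hcj'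
  have m := W.hasAllMoments (fj - fc)
  have mφ := (W.hasAllMoments_comp (hu j) (Nat.zero_le _) fj).sub
    (W.hasAllMoments_comp (hu c) (Nat.zero_le _) fc)
  have mc : HasAllMoments (fun _ : Ω => 2 * L ^ 2 * t ^ 2) P :=
    .of_bounded aestronglyMeasurable_const |2 * L ^ 2 * t ^ 2| fun _ => le_rfl
  have hle : ∫ ω, (u j 0 (W.integral fj ω) - u c 0 (W.integral fc ω)) ^ 2 ∂P
      ≤ ∫ ω, (2 * K ^ 2 * W.integral (fj - fc) ω ^ 2 + 2 * L ^ 2 * t ^ 2) ∂P := by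
    refine integral_mono_ae mφ.sq.integrable ((m.sq.const_mul _).add mc).integrable ?_
    filter_upwards [W.integral_sub_ae fj fc] with ω h
    have h1 := (hu j).abs_sub_le (j := 0) (by norm_num) (W.integral fc ω) (W.integral fj ω)
    have h2 := hlip c j hcj (W.integral fc ω)
    rw [← h] at h1
    have h3 : |u j 0 (W.integral fj ω) - u c 0 (W.integral fc ω)|
        ≤ K * |W.integral (fj - fc) ω| + L * t := by
      refine le_trans ?_ (add_le_add h1 h2)
      exact abs_sub_le _ _ _
    calc (u j 0 (W.integral fj ω) - u c 0 (W.integral fc ω)) ^ 2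
        ≤ (K * |W.integral (fj - fc) ω| + L * t) ^ 2 := sq_le_sq.2 (h3.trans (le_abs_self _))
      _ ≤ 2 * ((K * |W.integral (fj - fc) ω|) ^ 2 + (L * t) ^ 2) := add_sq_le
      _ = _ := by rw [mul_pow, sq_abs]; ring
  refine hle.trans ?_
  rw [integral_add (m.sq.const_mul _).integrable mc.integrable, integral_const_mul, W.integral_sq]
  simp only [integral_const, probReal_univ, smul_eq_mul, one_mul]
  nlinarith [sq_nonneg K]

end WhiteNoise

end

/-! ### Alternating sums -/

section

/-- Summation by parts for an alternating sum. -/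
theorem two_mul_sum_alternating (b : ℕ → ℝ) {c d : ℕ} (h : c ≤ d) :
    2 * ∑ j ∈ Finset.Ico c d, (-1) ^ j * b j
      = ∑ j ∈ Finset.Ico c d, (-1) ^ j * (b j - b (j + 1)) + (-1) ^ c * b c - (-1) ^ d * b d := by
  induction d, h using Nat.le_induction with
  | base => simp
  | succ d h ih =>
    rw [Finset.sum_Ico_succ_top h, Finset.sum_Ico_succ_top h, mul_add, ih]
    ring

/-- The pathwise decomposition of the alternating sum: up to a weighted sum of the `ℓ j` and of the
centred squares `X j ^ 2 - σ j`, what remains can be bounded term by term. -/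
theorem abs_sum_alternating_mul_sq_le {c d : ℕ} (hcd : c ≤ d) {φ X σ ℓ : ℕ → ℝ} {A K β : ℝ}
    (hφ : φ c = 0) (hσ0 : ∀ j, 0 ≤ σ j) (hσ : ∀ j, σ j ≤ β)
    (hd : ∀ j, |φ (j + 1) - φ j - ℓ j| ≤ A + K * X j ^ 2) :
    |∑ j ∈ Finset.Ico c d, (-1) ^ j * (φ j * X j ^ 2)|
      ≤ |∑ j ∈ Finset.Ico c d, (-1) ^ j * (φ j * (X j ^ 2 - σ j))|
        + 2⁻¹ * (|∑ j ∈ Finset.Ico c d, (-1) ^ j * σ (j + 1) * ℓ j|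
          + (Finset.Ico c d).card * (β * A) + β * K * ∑ j ∈ Finset.Ico c d, X j ^ 2
          + ∑ j ∈ Finset.Ico c d, |σ (j + 1) - σ j| * |φ j| + β * |φ d|) := by
  have hβ : 0 ≤ β := (hσ0 0).trans (hσ 0)
  set s := Finset.Ico c d
  have e1 : ∑ j ∈ s, (-1) ^ j * (φ j * X j ^ 2)
      = ∑ j ∈ s, (-1) ^ j * (φ j * (X j ^ 2 - σ j)) + ∑ j ∈ s, (-1) ^ j * (σ j * φ j) := by
    rw [← Finset.sum_add_distrib]
    exact Finset.sum_congr rfl fun j _ => by ring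
  have e2 := two_mul_sum_alternating (fun j => σ j * φ j) hcd
  have e3 : ∑ j ∈ s, (-1) ^ j * (σ j * φ j - σ (j + 1) * φ (j + 1))
      = -(∑ j ∈ s, (-1) ^ j * σ (j + 1) * ℓ j)
        - ∑ j ∈ s, (-1) ^ j * (σ (j + 1) * (φ (j + 1) - φ j - ℓ j))
        - ∑ j ∈ s, (-1) ^ j * ((σ (j + 1) - σ j) * φ j) := by
    rw [← Finset.sum_neg_distrib, ← Finset.sum_sub_distrib, ← Finset.sum_sub_distrib]
    exact Finset.sum_congr rfl fun j _ => by ring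
  simp only [hφ, mul_zero, add_zero] at e2
  rw [e3] at e2
  have b1 : |∑ j ∈ s, (-1) ^ j * (σ (j + 1) * (φ (j + 1) - φ j - ℓ j))|
      ≤ s.card * (β * A) + β * K * ∑ j ∈ s, X j ^ 2 := by
    calc _ ≤ ∑ j ∈ s, (β * A + β * K * X j ^ 2) := by
          refine (Finset.abs_sum_le_sum_abs _ _).trans (Finset.sum_le_sum fun j _ => ?_)
          rw [abs_mul, abs_neg_one_pow, one_mul, abs_mul, abs_of_nonneg (hσ0 _), mul_assoc,
            ← mul_add]
          exact mul_le_mul (hσ _) (hd j) (abs_nonneg _) hβ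
      _ = _ := by
          rw [Finset.sum_add_distrib, Finset.sum_const, nsmul_eq_mul, Finset.mul_sum]
  have b2 : |∑ j ∈ s, (-1) ^ j * ((σ (j + 1) - σ j) * φ j)|
      ≤ ∑ j ∈ s, |σ (j + 1) - σ j| * |φ j| := by
    refine (Finset.abs_sum_le_sum_abs _ _).trans_eq (Finset.sum_congr rfl fun j _ => ?_)
    rw [abs_mul, abs_neg_one_pow, one_mul, abs_mul]
  have b3 : |(-1) ^ d * (σ d * φ d)| ≤ β * |φ d| := by
    rw [abs_mul, abs_neg_one_pow, one_mul, abs_mul, abs_of_nonneg (hσ0 d)]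
    gcongr
    exact hσ d
  have b4 := le_refl |∑ j ∈ s, (-1) ^ j * σ (j + 1) * ℓ j|
  have b5 := le_refl |∑ j ∈ s, (-1) ^ j * (φ j * (X j ^ 2 - σ j))|
  rw [e1]
  refine (abs_add_le _ _).trans ?_
  gcongr
  rw [abs_le] at b1 b2 b3 b4 ⊢
  constructor <;> linarith [b1.1, b1.2, b2.1, b2.2, b3.1, b3.2, b4.1, b4.2]

theorem sq_le_six_mul_of_abs_le {S p q r s t u : ℝ} (h : |S| ≤ p + 2⁻¹ * (q + r + s + t + u)) :
    S ^ 2 ≤ 6 * (p ^ 2 + q ^ 2 + r ^ 2 + s ^ 2 + t ^ 2 + u ^ 2) := by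
  have h1 : S ^ 2 ≤ (p + 2⁻¹ * (q + r + s + t + u)) ^ 2 := sq_le_sq.2 (h.trans (le_abs_self _))
  have h2 := sq_sum_le_card_mul_sum_sq (s := (Finset.univ : Finset (Fin 6)))
    (f := ![p, 2⁻¹ * q, 2⁻¹ * r, 2⁻¹ * s, 2⁻¹ * t, 2⁻¹ * u])
  simp only [Fin.sum_univ_six, Matrix.cons_val, Finset.card_univ, Fintype.card_fin] at h2
  push_cast at h2
  nlinarith [sq_nonneg q, sq_nonneg r, sq_nonneg s, sq_nonneg t, sq_nonneg u]

variable {Ω : Type*} [MeasurableSpace Ω] {P : Measure Ω}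

theorem gridTime_mono (n : ℕ) : Monotone (gridTime n) := fun i j h => by
  unfold gridTime; gcongr

/-- Shifting the summation index by one turns `(-1) ^ j` into its opposite, whence the sign. -/
theorem IsHeatSolutionAt.alternatingSum_ae_eq {W : WhiteNoise P} {x : ℝ} {F : ℝ → Ω → ℝ}
    (hF : IsHeatSolutionAt W x F) (g : ℝ → ℝ → ℝ) (n c d : ℕ) :
    alternatingSum g F n c d =ᵐ[P] fun ω => -∑ j ∈ Finset.Ico c d, (-1) ^ j
      * ((g (W.integral (heatL2 x (gridTime n j)) ω) (gridTime n j)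
        - g (W.integral (heatL2 x (gridTime n c)) ω) (gridTime n c))
        * W.integral (stepL2 x n j) ω ^ 2) := by
  have h1 : ∀ᵐ ω ∂P, ∀ j, F (gridTime n j) ω = W.integral (heatL2 x (gridTime n j)) ω :=
    ae_all_iff.2 fun j => hF _ (gridTime_nonneg n j)
  have h2 : ∀ᵐ ω ∂P, ∀ j, W.integral (stepL2 x n j) ω
      = W.integral (heatL2 x (gridTime n (j + 1))) ω - W.integral (heatL2 x (gridTime n j)) ω :=
    ae_all_iff.2 fun j => W.integral_sub_ae _ _
  filter_upwards [h1, h2] with ω h1 h2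
  unfold alternatingSum increment
  have e : Finset.Icc (c + 1) d = Finset.Ico (c + 1) (d + 1) := by
    ext j
    simp only [Finset.mem_Icc, Finset.mem_Ico]
    omega
  rw [e, ← Finset.sum_Ico_add', ← Finset.sum_neg_distrib]
  refine Finset.sum_congr rfl fun j _ => ?_
  rw [Nat.add_sub_cancel, h1, h1, h1, h2]
  ring

/-- Elementary comparison of powers: all the error terms are of order `q ^ 3`, where `q ^ 2` is the
length of the time interval, `δ ^ 2` the mesh and `N` the number of grid intervals. -/
theorem error_terms_le {N δ q Q K L V : ℝ} (hδ : 0 ≤ δ) (hδq : δ ≤ q) (hqQ : q ≤ Q)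
    (hN : N * δ ^ 2 = q ^ 2) (hV : V = 4 * K ^ 2 * q + 2 * L ^ 2 * (q ^ 2) ^ 2) :
    N * (50 * δ ^ 2 * V + 64 * K ^ 2 * (20 * δ ^ 3 + 16 * δ ^ 4 * N))
      + N * (25 * K ^ 2 * (5 * δ ^ 3 + 16 * δ ^ 4 * N))
      + (N * (5 * δ * (L * δ ^ 2))) ^ 2 + (5 * δ * K) ^ 2 * (75 * δ ^ 2 * N ^ 2)
      + (2 * δ) ^ 2 * V + (5 * δ) ^ 2 * V
      ≤ (79 * (4 * K ^ 2 + 2 * L ^ 2 * Q ^ 3) + K ^ 2 * (1405 + 3299 * Q) + 25 * L ^ 2 * Q ^ 3)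
        * q ^ 3 := by
  have hq : 0 ≤ q := hδ.trans hδq
  have hQ : 0 ≤ Q := hq.trans hqQ
  have h1 : N * (50 * δ ^ 2 * V + 64 * K ^ 2 * (20 * δ ^ 3 + 16 * δ ^ 4 * N))
      = 50 * (N * δ ^ 2) * V + 64 * K ^ 2 * (20 * (N * δ ^ 2) * δ + 16 * (N * δ ^ 2) ^ 2) := by
    ring
  have h2 : N * (25 * K ^ 2 * (5 * δ ^ 3 + 16 * δ ^ 4 * N))
      = 25 * K ^ 2 * (5 * (N * δ ^ 2) * δ + 16 * (N * δ ^ 2) ^ 2) := by ring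
  have h3 : (N * (5 * δ * (L * δ ^ 2))) ^ 2 = 25 * L ^ 2 * δ ^ 2 * (N * δ ^ 2) ^ 2 := by ring
  have h4 : (5 * δ * K) ^ 2 * (75 * δ ^ 2 * N ^ 2) = 1875 * K ^ 2 * (N * δ ^ 2) ^ 2 := by ring
  have hV0 : 0 ≤ V := by rw [hV]; positivity
  have k1 : q ^ 2 * δ ≤ q ^ 3 := by rw [pow_succ q 2]; gcongr
  have k2 : (q ^ 2) ^ 2 ≤ Q * q ^ 3 := by
    rw [show (q ^ 2) ^ 2 = q * q ^ 3 by ring]; gcongr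
  have k3 : δ ^ 2 * (q ^ 2) ^ 2 ≤ Q ^ 3 * q ^ 3 := by
    calc δ ^ 2 * (q ^ 2) ^ 2 ≤ q ^ 2 * (q ^ 2) ^ 2 := by gcongr
      _ = q ^ 3 * q ^ 3 := by ring
      _ ≤ _ := by gcongr
  have k4 : q ^ 2 * V ≤ (4 * K ^ 2 + 2 * L ^ 2 * Q ^ 3) * q ^ 3 := by
    calc q ^ 2 * V = (4 * K ^ 2 + 2 * L ^ 2 * q ^ 3) * q ^ 3 := by rw [hV]; ring
      _ ≤ _ := by gcongr
  have k5 : δ ^ 2 * V ≤ q ^ 2 * V := by gcongr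
  rw [h1, h2, h3, h4, hN]
  have l1 := mul_le_mul_of_nonneg_left k1 (sq_nonneg K)
  have l2 := mul_le_mul_of_nonneg_left k2 (sq_nonneg K)
  have l3 := mul_le_mul_of_nonneg_left k3 (sq_nonneg L)
  linarith

variable [IsProbabilityMeasure P]

/-- The bound for the alternating sum, for a family `u j` of bounded smooth functions that is
Lipschitz in time. -/
theorem WhiteNoise.integral_alternating_sq_le (W : WhiteNoise P) (x : ℝ) {n : ℕ} (hn : 0 < n)
    {K L T : ℝ} {u : ℕ → ℕ → ℝ → ℝ} (hu : ∀ j, IsBoundedTower 4 K (u j))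
    (hlip : ∀ i j, i ≤ j → ∀ y, |u j 0 y - u i 0 y| ≤ L * (gridTime n j - gridTime n i))
    {c d : ℕ} (hcd : c < d) (hT : gridTime n d ≤ T) :
    ∫ ω, (∑ j ∈ Finset.Ico c d, (-1) ^ j * ((u j 0 (W.integral (heatL2 x (gridTime n j)) ω)
      - u c 0 (W.integral (heatL2 x (gridTime n c)) ω)) * W.integral (stepL2 x n j) ω ^ 2)) ^ 2 ∂P
      ≤ 6 * (79 * (4 * K ^ 2 + 2 * L ^ 2 * √T ^ 3) + K ^ 2 * (1405 + 3299 * √T)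
        + 25 * L ^ 2 * √T ^ 3) * √(gridTime n d - gridTime n c) ^ 3 := by
  set s := Finset.Ico c d with hs
  set δ := √(1 / (n : ℝ)) with hδ
  set q := √(gridTime n d - gridTime n c) with hq
  have hn' : (0 : ℝ) < n := by exact_mod_cast hn
  have hδ0 : 0 ≤ δ := Real.sqrt_nonneg _
  have hK : 0 ≤ K := (abs_nonneg _).trans ((hu 0).abs_le 0 (Nat.zero_le _) 0)
  have hδ2 : δ ^ 2 = 1 / n := Real.sq_sqrt (by positivity)
  have ht0 : 0 ≤ gridTime n d - gridTime n c := sub_nonneg.2 (gridTime_mono n hcd.le)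
  have hq2 : q ^ 2 = gridTime n d - gridTime n c := Real.sq_sqrt ht0
  have hcard : (s.card : ℝ) = d - c := by rw [hs, Nat.card_Ico, Nat.cast_sub hcd.le]
  have hN : s.card * δ ^ 2 = q ^ 2 := by
    rw [hq2, hδ2, hcard]
    unfold gridTime
    ring
  have hN1 : (1 : ℝ) ≤ s.card := by
    rw [hcard]
    have : (c : ℝ) + 1 ≤ d := by exact_mod_cast hcd
    linarith
  have hδq : δ ≤ q := by
    refine le_of_sq_le_sq ?_ (Real.sqrt_nonneg _)
    nlinarith [sq_nonneg δ]
  have hqQ : q ≤ √T := Real.sqrt_le_sqrt (by linarith [gridTime_nonneg n c])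
  have hstep : ∀ j, gridTime n (j + 1) - gridTime n j = δ ^ 2 := fun j => by
    rw [hδ2]
    unfold gridTime
    push_cast
    ring
  set V := 4 * K ^ 2 * q + 2 * L ^ 2 * (q ^ 2) ^ 2 with hV
  set Y : ℕ → Ω → ℝ := fun j => W.integral (heatL2 x (gridTime n j)) with hY
  set X : ℕ → Ω → ℝ := fun j => W.integral (stepL2 x n j) with hX
  set φ : ℕ → Ω → ℝ := fun j ω => u j 0 (Y j ω) - u c 0 (Y c ω) with hφ
  set σ : ℕ → ℝ := fun j => ‖stepL2 x n j‖ ^ 2 with hσ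
  have hσ0 : ∀ j, 0 ≤ σ j := fun j => sq_nonneg _
  have hσle : ∀ j, σ j ≤ 5 * δ := fun j => norm_stepL2_sq_le x n j
  have mX : ∀ j, HasAllMoments (X j) P := fun j => W.hasAllMoments _
  have mu : ∀ k ≤ 4, ∀ j, HasAllMoments (fun ω => u j k (Y j ω)) P :=
    fun k hk j => W.hasAllMoments_comp (hu j) hk _
  have mφ : ∀ j, HasAllMoments (φ j) P := fun j =>
    (mu 0 (by norm_num) j).sub (mu 0 (by norm_num) c)
  have hφV : ∀ j, c ≤ j → j ≤ d → ∫ ω, φ j ω ^ 2 ∂P ≤ V := fun j hcj hjd => by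
    refine (W.integral_fluctuation_sq_le x hcj hu hlip).trans ?_
    have h1 := sub_le_sub_right (gridTime_mono n hjd) (gridTime n c)
    have h2 := sub_nonneg.2 (gridTime_mono n hcj)
    rw [hV, hq2]
    have h3 := Real.sqrt_le_sqrt h1
    gcongr
  -- The terms of the pathwise decomposition other than the deterministic one.
  have E1 : ∫ ω, (∑ j ∈ s, (-1) ^ j * (φ j ω * (X j ω ^ 2 - σ j))) ^ 2 ∂P ≤ _ :=
    W.integral_sum_hermiteTwo_sq_le x hu c s fun j hj =>
      hφV j (Finset.mem_Ico.1 hj).1 (Finset.mem_Ico.1 hj).2.le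
  have E2 : ∫ ω, (∑ j ∈ s, (-1) ^ j * σ (j + 1) * (u j 1 (Y j ω) * X j ω)) ^ 2 ∂P ≤ _ :=
    W.integral_sum_linear_sq_le x (fun j => (hu j).shift) s (w := fun j => (-1) ^ j * σ (j + 1))
      fun j => by
        rw [abs_mul, abs_neg_one_pow, one_mul, abs_of_nonneg (hσ0 _)]
        exact hσle _
  have E3 : ∫ ω, (∑ j ∈ s, X j ω ^ 2) ^ 2 ∂P ≤ _ := W.integral_sum_sq_sq_le x s
  have E4 : ∫ ω, (∑ j ∈ s, |σ (j + 1) - σ j| * |φ j ω|) ^ 2 ∂P ≤ (2 * δ) ^ 2 * V := by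
    refine (integral_sum_sq_le s (B := fun i j => |σ (i + 1) - σ i| * |σ (j + 1) - σ j| * V)
      (fun j _ => (mφ j).abs.const_mul _) fun i hi j hj => ?_).trans ?_
    · rw [Finset.mem_Ico] at hi hj
      have h := abs_integral_mul_le_of_sq_le (mφ i).abs (mφ j).abs
        (by simpa using hφV i hi.1 hi.2.le) (by simpa using hφV j hj.1 hj.2.le)
      have e : ∫ ω, |σ (i + 1) - σ i| * |φ i ω| * (|σ (j + 1) - σ j| * |φ j ω|) ∂P
          = |σ (i + 1) - σ i| * |σ (j + 1) - σ j| * ∫ ω, |φ i ω| * |φ j ω| ∂P := by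
        rw [← integral_const_mul]
        refine integral_congr_ae (Eventually.of_forall fun ω => ?_)
        simp only
        ring
      rw [e, abs_mul, abs_of_nonneg (by positivity)]
      gcongr
    · simp_rw [mul_assoc, ← Finset.mul_sum, ← Finset.sum_mul, ← mul_assoc, ← pow_two]
      have h0 : 0 ≤ V := by positivity
      gcongr
      exact sum_abs_norm_stepL2_sq_sub_le x n s
  have E5 := hφV d hcd.le le_rfl
  have m1 : HasAllMoments (fun ω => ∑ j ∈ s, (-1) ^ j * (φ j ω * (X j ω ^ 2 - σ j))) P :=
    .sum fun j _ => ((mφ j).mul (W.hasAllMoments_hermiteTwo (stepL2 x n j))).const_mul _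
  have m2 : HasAllMoments (fun ω => ∑ j ∈ s, (-1) ^ j * σ (j + 1) * (u j 1 (Y j ω) * X j ω)) P :=
    .sum fun j _ => ((mu 1 (by norm_num) j).mul (mX j)).const_mul _
  have m3 : HasAllMoments (fun ω => ∑ j ∈ s, X j ω ^ 2) P := .sum fun j _ => (mX j).sq
  have m4 : HasAllMoments (fun ω => ∑ j ∈ s, |σ (j + 1) - σ j| * |φ j ω|) P :=
    .sum fun j _ => (mφ j).abs.const_mul _
  have mS : HasAllMoments (fun ω => ∑ j ∈ s, (-1) ^ j * (φ j ω * X j ω ^ 2)) P :=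
    .sum fun j _ => ((mφ j).mul (mX j).sq).const_mul _
  have mA : HasAllMoments (fun _ : Ω => (s.card * (5 * δ * (L * δ ^ 2))) ^ 2) P :=
    .of_bounded aestronglyMeasurable_const |(s.card * (5 * δ * (L * δ ^ 2))) ^ 2| fun _ => le_rfl
  have mtot := (((((m1.sq.add m2.sq).add mA).add (m3.sq.const_mul ((5 * δ * K) ^ 2))).add
    m4.sq).add ((mφ d).sq.const_mul ((5 * δ) ^ 2)))
  have hpath : ∫ ω, (∑ j ∈ s, (-1) ^ j * (φ j ω * X j ω ^ 2)) ^ 2 ∂P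
      ≤ ∫ ω, 6 * ((∑ j ∈ s, (-1) ^ j * (φ j ω * (X j ω ^ 2 - σ j))) ^ 2
        + (∑ j ∈ s, (-1) ^ j * σ (j + 1) * (u j 1 (Y j ω) * X j ω)) ^ 2
        + (s.card * (5 * δ * (L * δ ^ 2))) ^ 2 + (5 * δ * K) ^ 2 * (∑ j ∈ s, X j ω ^ 2) ^ 2
        + (∑ j ∈ s, |σ (j + 1) - σ j| * |φ j ω|) ^ 2 + (5 * δ) ^ 2 * φ d ω ^ 2) ∂P := by
    refine integral_mono_ae mS.sq.integrable (mtot.const_mul 6).integrable ?_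
    have hinc : ∀ᵐ ω ∂P, ∀ j, X j ω = Y (j + 1) ω - Y j ω :=
      ae_all_iff.2 fun j => W.integral_sub_ae _ _
    filter_upwards [hinc] with ω hω
    -- The increment of `φ` is a time increment plus a first order Taylor expansion in space.
    have h := abs_sum_alternating_mul_sq_le hcd.le (φ := fun j => φ j ω) (X := fun j => X j ω)
      (σ := σ) (ℓ := fun j => u j 1 (Y j ω) * X j ω) (A := L * δ ^ 2) (K := K) (β := 5 * δ)
      (sub_self _) hσ0 hσle fun j => by
        have h1 := hlip j (j + 1) (Nat.le_succ j) (Y (j + 1) ω)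
        have h2 := (hu j).abs_taylor_le (by norm_num) (Y j ω) (Y (j + 1) ω)
        rw [hstep] at h1
        rw [← hω] at h2
        refine le_trans (le_of_eq ?_) ((abs_add_le _ _).trans (add_le_add h1 h2))
        congr 1
        simp only [hφ]
        ring
    refine (sq_le_six_mul_of_abs_le h).trans_eq ?_
    rw [mul_pow (5 * δ * K), mul_pow (5 * δ) |φ d ω|, sq_abs, sq_abs, sq_abs]
  refine hpath.trans ?_
  rw [integral_const_mul, mul_assoc 6]
  gcongr
  rw [integral_add ((((m1.sq.add m2.sq).add mA).add (m3.sq.const_mul _)).add m4.sq).integrable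
      ((mφ d).sq.const_mul _).integrable,
    integral_add (((m1.sq.add m2.sq).add mA).add (m3.sq.const_mul _)).integrable m4.sq.integrable,
    integral_add ((m1.sq.add m2.sq).add mA).integrable (m3.sq.const_mul _).integrable,
    integral_add (m1.sq.add m2.sq).integrable mA.integrable,
    integral_add m1.sq.integrable m2.sq.integrable, integral_const_mul, integral_const_mul]
  refine le_trans ?_ (error_terms_le hδ0 hδq hqQ hN hV)
  simp only [integral_const, probReal_univ, one_smul]
  gcongr

end

end QuarticHeat

end

open QuarticHeat in
theorem theorem5p1 (g : ℝ → ℝ → ℝ) (hg : IsCkr 7 2 g)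
    (hsupp : HasCompactSupport (fun q : ℝ × ℝ≥0 => g q.1 q.2)) (T : ℝ) (hT : 0 < T) :
    ∃ C : ℝ, ∀ {Ω : Type*} [MeasurableSpace Ω] (P : Measure Ω) [IsProbabilityMeasure P]
      (W : WhiteNoise P) (x : ℝ) (F : ℝ → Ω → ℝ), IsHeatSolutionAt W x F →
      ∀ n c d : ℕ, 0 < n → gridTime n c < gridTime n d → gridTime n d ≤ T →
        Integrable (fun ω => |alternatingSum g F n c d ω| ^ 2) P ∧
        ∫ ω, |alternatingSum g F n c d ω| ^ 2 ∂P
          ≤ C * |gridTime n d - gridTime n c| ^ (3 / 2 : ℝ) := by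
  obtain ⟨K, hK⟩ := hg.exists_isBoundedTower hsupp
  obtain ⟨L, hlip⟩ := hg.exists_lipschitz_time hsupp
  refine ⟨6 * (79 * (4 * K ^ 2 + 2 * L ^ 2 * √T ^ 3) + K ^ 2 * (1405 + 3299 * √T)
    + 25 * L ^ 2 * √T ^ 3), fun P _ W x F hF n c d hn hcd hdT => ?_⟩
  have hcd' : c < d := lt_of_not_ge fun h => hcd.not_ge (gridTime_mono n h)
  have hu : ∀ j, IsBoundedTower 4 K (fun k y => partialX g k y (gridTime n j)) :=
    fun j => (hK _ (gridTime_nonneg n j)).mono (by norm_num)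
  have hae := hF.alternatingSum_ae_eq g n c d
  have hsq : (fun ω => |alternatingSum g F n c d ω| ^ 2) =ᵐ[P] fun ω =>
      (∑ j ∈ Finset.Ico c d, (-1) ^ j
        * ((partialX g 0 (W.integral (heatL2 x (gridTime n j)) ω) (gridTime n j)
          - partialX g 0 (W.integral (heatL2 x (gridTime n c)) ω) (gridTime n c))
          * W.integral (stepL2 x n j) ω ^ 2)) ^ 2 := by
    filter_upwards [hae] with ω h
    rw [h, sq_abs, neg_sq]
    simp only [partialX_zero]
  have mφ : ∀ j, HasAllMoments (fun ω =>
      partialX g 0 (W.integral (heatL2 x (gridTime n j)) ω) (gridTime n j)) P :=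
    fun j => W.hasAllMoments_comp (hu j) (Nat.zero_le _) _
  refine ⟨(HasAllMoments.sum fun j _ => (((mφ j).sub (mφ c)).mul
    (W.hasAllMoments (stepL2 x n j)).sq).const_mul _).sq.integrable.congr hsq.symm, ?_⟩
  have hpow : |gridTime n d - gridTime n c| ^ (3 / 2 : ℝ)
      = √(gridTime n d - gridTime n c) ^ 3 := by
    rw [abs_of_pos (sub_pos.2 hcd), Real.sqrt_eq_rpow, ← Real.rpow_natCast, ← Real.rpow_mul
      (sub_pos.2 hcd).le]
    norm_num
  rw [integral_congr_ae hsq, hpow]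
  exact W.integral_alternating_sq_le x hn hu (fun i j hij y => by
    simpa only [partialX_zero] using hlip y _ _ (gridTime_nonneg n i) (gridTime_mono n hij))
    hcd' hdT
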